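/- Let $n\ge 1$, let $\Omega\subset\mathbb R^n$ be a bounded open set with Lipschitz boundary, and let $f:\mathbb R^n\to\mathbb R$ be a continuous function such that $$f(\xi)\ge\gamma(|\xi|)\qquad\text{for all }\xi\in\mathbb R^n,$$ where $\gamma:[0,\infty)\to[0,\infty)$ is continuous and increasing with $\lim_{t\to+\infty}\gamma(t)=+\infty$. Let $u_0\in W^{1,\infty}(\Omega)$, and let $W^{1,\infty}_0(\Omega)$ denote the set of functions of $W^{1,\infty}(\Omega)$ that lie in the closure of $C_c^\infty(\Omega)$ in $W^{1,1}(\Omega)$. For $u\in u_0+W_0^{1,\infty}(\Omega)$ put $$F(u)=\operatorname*{ess\,sup}_{x\in\Omega}f(\nabla u(x)),$$ and let $\overline F$ be the relaxed functional of $F$ with respect to weak-$*$ convergence in $W^{1,\infty}(\Omega)$: $$\overline F(u)=\inf\Big\{\liminf_{h\to+\infty}F(u_h):\ u_h\in u_0+W^{1,\infty}_0(\Omega),\ u_h\overset{*}{\rightharpoonup}u\text{ in }W^{1,\infty}(\Omega)\Big\},$$ where $u_h\overset{*}{\rightharpoonup}u$ in $W^{1,\infty}(\Omega)$ means that $u_h\overset{*}{\rightharpoonup}u$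 in $L^\infty(\Omega)$ and $\nabla u_h\overset{*}{\rightharpoonup}\nabla u$ in $L^\infty(\Omega;\mathbb R^n)$. Let $f^{\rm lslc}$ be the lower semicontinuous level convex envelope of $f$, i.e. $f^{\rm lslc}(\xi)$ is the supremum of $g(\xi)$ over all lower semicontinuous functions $g:\mathbb R^n\to[-\infty,+\infty]$ with $g\le f$ whose sublevel sets $\{\eta\in\mathbb R^n:\ g(\eta)\le c\}$, $c\in\mathbb R$, are all convex. Then $$\overline F(u)=\operatorname*{ess\,sup}_{x\in\Omega}f^{\rm lslc}(\nabla u(x))\qquad\text{for all }u\in u_0+W^{1,\infty}_0(\Omega).$$ -/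

import Mathlib

open MeasureTheory Filter Topology Set
open scoped NNReal ENNReal ContDiff

noncomputable section

/-- Euclidean space `ℝⁿ`. -/
abbrev RSpace (n : ℕ) : Type := EuclideanSpace ℝ (Fin n)

variable {n : ℕ}

/-- `Ω` has Lipschitz boundary: near each boundary point, after a rotation, `Ω` is the set of points
lying strictly below the graph of a Lipschitz function. Here `e` is the vertical direction,
`⟪e, y⟫` the height of `y`, and `y - ⟪e, y⟫ e` its horizontal part. -/
def HasLipschitzBoundary (Ω : Set (RSpace n)) : Prop :=
  ∀ x₀ ∈ frontier Ω, ∃ r : ℝ, 0 < r ∧ ∃ e : RSpace n, ‖e‖ = 1 ∧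
    ∃ (K : ℝ≥0) (g : RSpace n → ℝ), LipschitzWith K g ∧
      ∀ y ∈ Metric.ball x₀ r, (y ∈ Ω ↔ inner ℝ e y < g (y - inner ℝ e y • e))

/-- `φ ∈ C_c^∞(Ω)`. -/
structure IsTestFunction (Ω : Set (RSpace n)) (φ : RSpace n → ℝ) : Prop where
  contDiff : ContDiff ℝ ∞ φ
  hasCompactSupport : HasCompactSupport φ
  tsupport_subset : tsupport φ ⊆ Ω

/-- `G` is a weak (distributional) gradient of `u` in `Ω`. -/
structure HasWeakGradient (Ω : Set (RSpace n)) (u : RSpace n → ℝ) (G : RSpace n → RSpace n) :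
    Prop where
  locallyIntegrableOn : LocallyIntegrableOn u Ω
  locallyIntegrableOn_grad : LocallyIntegrableOn G Ω
  integral_eq : ∀ φ : RSpace n → ℝ, IsTestFunction Ω φ → ∀ v : RSpace n,
    ∫ x in Ω, u x * fderiv ℝ φ x v = - ∫ x in Ω, inner ℝ v (G x) * φ x

open Classical in
/-- The weak gradient `∇u` of `u` in `Ω` (a choice of representative; it is `0` if `u` has no weak
gradient). -/
def weakGrad (Ω : Set (RSpace n)) (u : RSpace n → ℝ) : RSpace n → RSpace n :=
  if h : ∃ G, HasWeakGradient Ω u G then h.choose else 0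

/-- `u ∈ W^{1,∞}(Ω)`. Functions are defined on all of `ℝⁿ`, but only their restrictions to `Ω`,
up to null sets, matter. -/
def MemW1Infty (Ω : Set (RSpace n)) (u : RSpace n → ℝ) : Prop :=
  MemLp u ∞ (volume.restrict Ω) ∧
    ∃ G, HasWeakGradient Ω u G ∧ MemLp G ∞ (volume.restrict Ω)

/-- `u ∈ W_0^{1,∞}(Ω)`: `u ∈ W^{1,∞}(Ω)` and `u` is in the closure of `C_c^∞(Ω)` for the norm
of `W^{1,1}(Ω)`. -/
def MemW1InftyZero (Ω : Set (RSpace n)) (u : RSpace n → ℝ) : Prop :=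
  MemW1Infty Ω u ∧ ∃ φ : ℕ → RSpace n → ℝ, (∀ k, IsTestFunction Ω (φ k)) ∧
    Tendsto (fun k => eLpNorm (fun x => u x - φ k x) 1 (volume.restrict Ω)) atTop (𝓝 0) ∧
    Tendsto (fun k => eLpNorm (fun x => weakGrad Ω u x - gradient (φ k) x) 1 (volume.restrict Ω))
      atTop (𝓝 0)

/-- The affine class `u₀ + W_0^{1,∞}(Ω)`. -/
def dirichletClass (Ω : Set (RSpace n)) (u₀ : RSpace n → ℝ) : Set (RSpace n → ℝ) :=
  {u | MemW1InftyZero Ω (u - u₀)}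

/-- Weak-* convergence `u_h ⇀* u` in `W^{1,∞}(Ω)`: `u_h ⇀* u` in `L^∞(Ω)` and
`∇u_h ⇀* ∇u` in `L^∞(Ω; ℝⁿ)`. -/
def WeakStarTendsto (Ω : Set (RSpace n)) (us : ℕ → RSpace n → ℝ) (u : RSpace n → ℝ) : Prop :=
  (∀ g : RSpace n → ℝ, Integrable g (volume.restrict Ω) →
    Tendsto (fun h => ∫ x in Ω, us h x * g x) atTop (𝓝 (∫ x in Ω, u x * g x))) ∧
  (∀ g : RSpace n → RSpace n, Integrable g (volume.restrict Ω) →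
    Tendsto (fun h => ∫ x in Ω, inner ℝ (weakGrad Ω (us h) x) (g x)) atTop
      (𝓝 (∫ x in Ω, inner ℝ (weakGrad Ω u x) (g x))))

/-- The supremal functional `u ↦ ess sup_{x ∈ Ω} f(∇u(x))`. -/
def supremalFunctional (Ω : Set (RSpace n)) (f : RSpace n → EReal) (u : RSpace n → ℝ) : EReal :=
  essSup (fun x => f (weakGrad Ω u x)) (volume.restrict Ω)

/-- The relaxation at `u` of a functional `F` on the class `A` with respect to weak-* convergence
in `W^{1,∞}(Ω)`: the infimum of `liminf F(u_h)` over sequences in `A` with `u_h ⇀* u`. -/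
def relaxedFunctional (Ω : Set (RSpace n)) (A : Set (RSpace n → ℝ))
    (F : (RSpace n → ℝ) → EReal) (u : RSpace n → ℝ) : EReal :=
  sInf {l : EReal | ∃ us : ℕ → RSpace n → ℝ, (∀ h, us h ∈ A) ∧ WeakStarTendsto Ω us u ∧
    l = liminf (fun h => F (us h)) atTop}

/-- Level convexity: the sublevel sets `{f ≤ c}`, `c ∈ ℝ`, are convex. -/
def IsLevelConvex (f : RSpace n → EReal) : Prop :=
  ∀ c : ℝ, Convex ℝ {ξ | f ξ ≤ (c : EReal)}

/-- The lower semicontinuous level convex envelope `f^lslc`: the pointwise supremum of all lower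
semicontinuous level convex functions `g ≤ f`. -/
def lslcEnvelope (f : RSpace n → EReal) (ξ : RSpace n) : EReal :=
  sSup {y : EReal | ∃ g : RSpace n → EReal,
    LowerSemicontinuous g ∧ IsLevelConvex g ∧ (∀ η, g η ≤ f η) ∧ y = g ξ}

theorem weakGrad_spec {Ω : Set (RSpace n)} {u : RSpace n → ℝ}
    (h : ∃ G, HasWeakGradient Ω u G) : HasWeakGradient Ω u (weakGrad Ω u) := by
  rw [weakGrad, dif_pos h]
  exact h.choose_spec

/-- Weak gradients are unique almost everywhere. -/
theorem HasWeakGradient.ae_eq {Ω : Set (RSpace n)} (hΩ : IsOpen Ω) {u : RSpace n → ℝ}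
    {G H : RSpace n → RSpace n} (hG : HasWeakGradient Ω u G) (hH : HasWeakGradient Ω u H) :
    G =ᵐ[volume.restrict Ω] H := by
  have key : ∀ v : RSpace n, ∀ᵐ x ∂(volume : Measure (RSpace n)), x ∈ Ω →
      inner ℝ v (G x - H x) = 0 := by
    intro v
    have hl : ∀ {G : RSpace n → RSpace n}, LocallyIntegrableOn G Ω →
        LocallyIntegrableOn (fun x => (inner ℝ v (G x) : ℝ)) Ω := by
      intro G hG x hx
      obtain ⟨s, hs, hi⟩ := hG x hx
      exact ⟨s, hs, Integrable.const_inner v hi⟩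
    refine hΩ.ae_eq_zero_of_integral_contDiff_smul_eq_zero
      (f := fun x => (inner ℝ v (G x - H x) : ℝ)) ?_ ?_
    · exact hl (hG.2.sub hH.2)
    · intro φ h1 h2 h3
      have hφ : IsTestFunction Ω φ := ⟨h1, h2, h3⟩
      have hint : ∀ {G : RSpace n → RSpace n}, LocallyIntegrableOn G Ω →
          Integrable (fun x => inner ℝ v (G x) * φ x) (volume.restrict Ω) := by
        intro G hG
        have hK := (hl hG).integrableOn_compact_subset h3 h2.isCompact
        have : IntegrableOn (fun x => inner ℝ v (G x) * φ x) (tsupport φ) :=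
          hK.mul_continuousOn h1.continuous.continuousOn h2.isCompact
        refine ((integrableOn_iff_integrable_of_support_subset ?_).1 this).integrableOn
        exact (Function.support_mul_subset_right _ _).trans (subset_tsupport φ)
      have e := (hG.3 φ hφ v).symm.trans (hH.3 φ hφ v)
      have hs : ∀ x ∉ Ω, φ x • (inner ℝ v (G x - H x) : ℝ) = 0 := by
        intro x hx
        rw [image_eq_zero_of_notMem_tsupport (fun h => hx (h3 h)), zero_smul]
      rw [← setIntegral_eq_integral_of_forall_compl_eq_zero hs]
      have : ∀ x, φ x • (inner ℝ v (G x - H x) : ℝ)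
          = inner ℝ v (G x) * φ x - inner ℝ v (H x) * φ x := by
        intro x
        rw [inner_sub_right, smul_eq_mul]
        ring
      simp_rw [this]
      rw [integral_sub (hint hG.2) (hint hH.2)]
      linarith
  rw [Filter.EventuallyEq, ae_restrict_iff' hΩ.measurableSet]
  have := ae_all_iff.2 fun i : Fin n => key (EuclideanSpace.single i 1)
  filter_upwards [this] with x hx hxΩ
  ext i
  have h := hx i hxΩ
  simp [EuclideanSpace.inner_single_left] at h
  linarith

end

/-! The inequality "≥" is weak-* lower semicontinuity: the sublevel sets of the envelope are closed
and convex, and a closed convex constraint on gradients is an intersection of countably many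
half-space constraints, each of which survives weak-* limits (`WeakStarTendsto.ae_weakGrad_mem`).

For "≤", take reals `c₁ < c` above the ess sup of the envelope along `∇u`, and let `H` be the
support function of the compact, possibly nonconvex, set `A = {f ≤ c}`. Wherever `H` is
differentiable its gradient is a maximizer, hence lies in `A` (`IsCompact.exists_support_function`).
The gap `c₁ < c` places `∇u` a.e. inside the closed convex hull of `A` with a uniform margin `δ`,
that is `⟪∇u, y⟫ + δ‖y‖ ≤ H y` (`exists_margin_of_lslcEnvelope_lt`).

Near a point `x₀` of differentiability, the cone `H (y - x₀) + t` with `t` slightly less than `u x₀`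
therefore lies below `u` only on a small neighbourhood of `x₀`. Replacing `u` by the cone there
subtracts a small nonnegative Lipschitz function (`exists_isLocalCorrection`). A Vitali covering
fills almost all of `Ω` with disjoint such neighbourhoods (`exists_lipschitz_correction`), so the
new function has gradient in `A` a.e. The Lipschitz constant of the correction does not depend on
its height, so letting the height tend to zero gives a recovery sequence. -/

/-! ### Calculus of test functions, weak gradients and Sobolev classes. -/

theorem IsTestFunction.mono {n : ℕ} {Ω Ω' : Set (RSpace n)} {φ : RSpace n → ℝ}
    (h : IsTestFunction Ω' φ) (hs : Ω' ⊆ Ω) : IsTestFunction Ω φ :=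
  ⟨h.1, h.2, h.3.trans hs⟩

theorem IsTestFunction.eq_zero {n : ℕ} {Ω : Set (RSpace n)} {φ : RSpace n → ℝ}
    (h : IsTestFunction Ω φ) {x : RSpace n} (hx : x ∉ Ω) : φ x = 0 :=
  image_eq_zero_of_notMem_tsupport fun h' => hx (h.3 h')

theorem IsTestFunction.fderiv_eq_zero {n : ℕ} {Ω : Set (RSpace n)} {φ : RSpace n → ℝ}
    (h : IsTestFunction Ω φ) {x : RSpace n} (hx : x ∉ Ω) : fderiv ℝ φ x = 0 :=
  fderiv_of_notMem_tsupport (𝕜 := ℝ) fun h' => hx (h.3 h')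

theorem IsTestFunction.setIntegral_mul_eq {n : ℕ} {Ω : Set (RSpace n)} {φ : RSpace n → ℝ}
    (h : IsTestFunction Ω φ) (F : RSpace n → ℝ) : ∫ x in Ω, F x * φ x = ∫ x, F x * φ x :=
  setIntegral_eq_integral_of_forall_compl_eq_zero fun x hx => by rw [h.eq_zero hx, mul_zero]

theorem IsTestFunction.setIntegral_mul_fderiv_eq {n : ℕ} {Ω : Set (RSpace n)} {φ : RSpace n → ℝ}
    (h : IsTestFunction Ω φ) (F : RSpace n → ℝ) (v : RSpace n) :
    ∫ x in Ω, F x * fderiv ℝ φ x v = ∫ x, F x * fderiv ℝ φ x v :=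
  setIntegral_eq_integral_of_forall_compl_eq_zero fun x hx => by simp [h.fderiv_eq_zero hx]

theorem IsTestFunction.integrable_mul {n : ℕ} {Ω : Set (RSpace n)} {φ : RSpace n → ℝ}
    (h : IsTestFunction Ω φ) {F : RSpace n → ℝ} (hF : LocallyIntegrableOn F Ω) :
    Integrable (fun x => F x * φ x) (volume.restrict Ω) := by
  have hK := hF.integrableOn_compact_subset h.3 h.2.isCompact
  have : IntegrableOn (fun x => F x * φ x) (tsupport φ) :=
    hK.mul_continuousOn h.1.continuous.continuousOn h.2.isCompact
  refine ((integrableOn_iff_integrable_of_support_subset ?_).1 this).integrableOn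
  exact (Function.support_mul_subset_right _ _).trans (subset_tsupport φ)

theorem IsTestFunction.integrable_mul_fderiv {n : ℕ} {Ω : Set (RSpace n)} {φ : RSpace n → ℝ}
    (h : IsTestFunction Ω φ) {F : RSpace n → ℝ} (hF : LocallyIntegrableOn F Ω) (v : RSpace n) :
    Integrable (fun x => F x * fderiv ℝ φ x v) (volume.restrict Ω) := by
  have hK := hF.integrableOn_compact_subset h.3 h.2.isCompact
  have : IntegrableOn (fun x => F x * fderiv ℝ φ x v) (tsupport φ) :=
    hK.mul_continuousOn ((h.1.continuous_fderiv (by simp)).clm_apply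
      continuous_const).continuousOn h.2.isCompact
  refine ((integrableOn_iff_integrable_of_support_subset ?_).1 this).integrableOn
  refine (Function.support_mul_subset_right _ _).trans fun x hx => ?_
  by_contra hx'
  exact hx (by simp [fderiv_of_notMem_tsupport (𝕜 := ℝ) hx'])

theorem LocallyIntegrableOn.inner_left {n : ℕ} {Ω : Set (RSpace n)} {G : RSpace n → RSpace n}
    (hG : LocallyIntegrableOn G Ω) (v : RSpace n) :
    LocallyIntegrableOn (fun x => (inner ℝ v (G x) : ℝ)) Ω := by
  intro x hx
  obtain ⟨s, hs, hi⟩ := hG x hx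
  exact ⟨s, hs, Integrable.const_inner v hi⟩

theorem HasWeakGradient.mono {n : ℕ} {Ω Ω' : Set (RSpace n)} {u : RSpace n → ℝ}
    {G : RSpace n → RSpace n} (h : HasWeakGradient Ω u G) (hs : Ω' ⊆ Ω) :
    HasWeakGradient Ω' u G := by
  refine ⟨h.1.mono_set hs, h.2.mono_set hs, fun φ hφ v => ?_⟩
  have := h.3 φ (hφ.mono hs) v
  rwa [(hφ.mono hs).setIntegral_mul_fderiv_eq, (hφ.mono hs).setIntegral_mul_eq,
    ← hφ.setIntegral_mul_fderiv_eq, ← hφ.setIntegral_mul_eq] at this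

theorem LocallyIntegrableOn.congr_restrict {n : ℕ} {E : Type*} [NormedAddCommGroup E]
    {Ω : Set (RSpace n)} {u v : RSpace n → E}
    (h : LocallyIntegrableOn u Ω) (huv : u =ᵐ[volume.restrict Ω] v) :
    LocallyIntegrableOn v Ω := by
  intro x hx
  obtain ⟨s, hs, hi⟩ := h x hx
  refine ⟨s ∩ Ω, Filter.inter_mem hs self_mem_nhdsWithin, ?_⟩
  exact (hi.mono_set inter_subset_left).congr
    (ae_mono (Measure.restrict_mono inter_subset_right le_rfl) huv)

theorem HasWeakGradient.congr {n : ℕ} {Ω : Set (RSpace n)} {u v : RSpace n → ℝ}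
    {G : RSpace n → RSpace n} (h : HasWeakGradient Ω u G) (huv : u =ᵐ[volume.restrict Ω] v) :
    HasWeakGradient Ω v G := by
  refine ⟨LocallyIntegrableOn.congr_restrict h.1 huv, h.2, fun φ hφ w => ?_⟩
  rw [← h.3 φ hφ w]
  refine integral_congr_ae ?_
  filter_upwards [huv] with x hx
  rw [hx]

theorem HasWeakGradient.sub {n : ℕ} {Ω : Set (RSpace n)} {u v : RSpace n → ℝ}
    {G H : RSpace n → RSpace n} (hu : HasWeakGradient Ω u G) (hv : HasWeakGradient Ω v H) :
    HasWeakGradient Ω (u - v) (G - H) := by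
  refine ⟨hu.1.sub hv.1, hu.2.sub hv.2, fun φ hφ w => ?_⟩
  have e1 : ∀ x, (u - v) x * fderiv ℝ φ x w = u x * fderiv ℝ φ x w - v x * fderiv ℝ φ x w :=
    fun x => by simp [sub_mul]
  have e2 : ∀ x, inner ℝ w ((G - H) x) * φ x = inner ℝ w (G x) * φ x - inner ℝ w (H x) * φ x :=
    fun x => by simp [inner_sub_right, sub_mul]
  simp_rw [e1, e2]
  rw [integral_sub (hφ.integrable_mul_fderiv hu.1 w) (hφ.integrable_mul_fderiv hv.1 w),
    integral_sub (hφ.integrable_mul (LocallyIntegrableOn.inner_left hu.2 w))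
      (hφ.integrable_mul (LocallyIntegrableOn.inner_left hv.2 w)), hu.3 φ hφ w, hv.3 φ hφ w]
  ring

theorem LipschitzWith.norm_gradient_le {n : ℕ} {K : ℝ≥0} {w : RSpace n → ℝ}
    (hw : LipschitzWith K w) (x : RSpace n) : ‖gradient w x‖ ≤ K := by
  rw [gradient, LinearIsometryEquiv.norm_map]
  exact norm_fderiv_le_of_lipschitz ℝ hw

theorem measurable_gradient {n : ℕ} (w : RSpace n → ℝ) : Measurable (gradient w) :=
  (InnerProductSpace.toDual ℝ (RSpace n)).symm.continuous.measurable.comp (measurable_fderiv ℝ w)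

theorem inner_gradient_eq_fderiv {n : ℕ} (w : RSpace n → ℝ) (x v : RSpace n) :
    inner ℝ v (gradient w x) = fderiv ℝ w x v := by
  rw [real_inner_comm, inner_gradient_left]

/-- The classical gradient of a Lipschitz function is its weak gradient. -/
theorem LipschitzWith.hasWeakGradient {n : ℕ} {K : ℝ≥0} {w : RSpace n → ℝ}
    (hw : LipschitzWith K w) (Ω : Set (RSpace n)) : HasWeakGradient Ω w (gradient w) := by
  have hl : LocallyIntegrable (gradient w) (volume : Measure (RSpace n)) := by
    refine (locallyIntegrable_const (K : ℝ)).mono (measurable_gradient w).aestronglyMeasurable ?_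
    refine Eventually.of_forall fun x => ?_
    simpa using hw.norm_gradient_le x
  refine ⟨hw.continuous.locallyIntegrable.locallyIntegrableOn _, hl.locallyIntegrableOn _,
    fun φ hφ v => ?_⟩
  obtain ⟨D, hD⟩ := ContDiff.lipschitzWith_of_hasCompactSupport hφ.2 hφ.1 (by simp)
  have key := hw.integral_lineDeriv_mul_eq (μ := volume) hD hφ.2 v
  rw [hφ.setIntegral_mul_fderiv_eq, hφ.setIntegral_mul_eq]
  have e1 : ∫ x, inner ℝ v (gradient w x) * φ x = ∫ x, lineDeriv ℝ w x v * φ x := by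
    refine integral_congr_ae ?_
    filter_upwards [hw.ae_differentiableAt] with x hx
    rw [inner_gradient_eq_fderiv, hx.lineDeriv_eq_fderiv]
  have e2 : ∀ x, lineDeriv ℝ φ x (-v) * w x = -(w x * fderiv ℝ φ x v) := by
    intro x
    rw [(hφ.1.differentiable (by simp)).differentiableAt.lineDeriv_eq_fderiv, map_neg]
    ring
  rw [e1, key]
  simp_rw [e2]
  rw [integral_neg, neg_neg]

theorem weakGrad_ae_eq {n : ℕ} {Ω : Set (RSpace n)} (hΩ : IsOpen Ω) {u : RSpace n → ℝ}
    {G : RSpace n → RSpace n} (hG : HasWeakGradient Ω u G) :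
    weakGrad Ω u =ᵐ[volume.restrict Ω] G :=
  (weakGrad_spec ⟨G, hG⟩).ae_eq hΩ hG

theorem MemW1Infty.hasWeakGradient {n : ℕ} {Ω : Set (RSpace n)} {u : RSpace n → ℝ}
    (hu : MemW1Infty Ω u) : HasWeakGradient Ω u (weakGrad Ω u) :=
  weakGrad_spec ⟨_, hu.2.choose_spec.1⟩

theorem MemW1Infty.memLp_weakGrad {n : ℕ} {Ω : Set (RSpace n)} (hΩ : IsOpen Ω)
    {u : RSpace n → ℝ} (hu : MemW1Infty Ω u) : MemLp (weakGrad Ω u) ∞ (volume.restrict Ω) := by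
  obtain ⟨G, hG, hG'⟩ := hu.2
  exact hG'.ae_eq (weakGrad_ae_eq hΩ hG).symm

theorem MemW1Infty.sub {n : ℕ} {Ω : Set (RSpace n)} {u v : RSpace n → ℝ}
    (hu : MemW1Infty Ω u) (hv : MemW1Infty Ω v) : MemW1Infty Ω (u - v) := by
  obtain ⟨G, hG, hG'⟩ := hu.2
  obtain ⟨H, hH, hH'⟩ := hv.2
  exact ⟨hu.1.sub hv.1, G - H, hG.sub hH, hG'.sub hH'⟩

theorem MemW1Infty.weakGrad_sub_ae_eq {n : ℕ} {Ω : Set (RSpace n)} (hΩ : IsOpen Ω)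
    {u v : RSpace n → ℝ} (hu : MemW1Infty Ω u) (hv : MemW1Infty Ω v) :
    weakGrad Ω (u - v) =ᵐ[volume.restrict Ω] weakGrad Ω u - weakGrad Ω v :=
  weakGrad_ae_eq hΩ (hu.hasWeakGradient.sub hv.hasWeakGradient)

theorem IsTestFunction.sub {n : ℕ} {Ω : Set (RSpace n)} {φ ψ : RSpace n → ℝ}
    (hφ : IsTestFunction Ω φ) (hψ : IsTestFunction Ω ψ) : IsTestFunction Ω (φ - ψ) :=
  ⟨hφ.1.sub hψ.1, hφ.2.sub hψ.2,
    (tsupport_sub φ ψ).trans (union_subset hφ.3 hψ.3)⟩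

theorem gradient_sub_apply {n : ℕ} {u v : RSpace n → ℝ} {x : RSpace n}
    (hu : DifferentiableAt ℝ u x) (hv : DifferentiableAt ℝ v x) :
    gradient (u - v) x = gradient u x - gradient v x := by
  simp only [gradient]
  rw [fderiv_sub hu hv, map_sub]

theorem MemW1InftyZero.sub {n : ℕ} {Ω : Set (RSpace n)} (hΩ : IsOpen Ω) {u v : RSpace n → ℝ}
    (hu : MemW1InftyZero Ω u) (hv : MemW1InftyZero Ω v) : MemW1InftyZero Ω (u - v) := by
  obtain ⟨hu, φ, hφ, hφ1, hφ2⟩ := hu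
  obtain ⟨hv, ψ, hψ, hψ1, hψ2⟩ := hv
  have key : ∀ {E : Type} [NormedAddCommGroup E] {a b c : ℕ → RSpace n → E},
      (∀ k, AEStronglyMeasurable (a k) (volume.restrict Ω)) →
      (∀ k, AEStronglyMeasurable (b k) (volume.restrict Ω)) →
      (∀ k, c k =ᵐ[volume.restrict Ω] a k - b k) →
      Tendsto (fun k => eLpNorm (a k) 1 (volume.restrict Ω)) atTop (𝓝 0) →
      Tendsto (fun k => eLpNorm (b k) 1 (volume.restrict Ω)) atTop (𝓝 0) →
      Tendsto (fun k => eLpNorm (c k) 1 (volume.restrict Ω)) atTop (𝓝 0) := by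
    intro E _ a b c ha hb hc h1 h2
    have h3 := h1.add h2
    rw [add_zero] at h3
    refine tendsto_of_tendsto_of_tendsto_of_le_of_le tendsto_const_nhds h3
      (fun k => zero_le) fun k => ?_
    show eLpNorm (c k) 1 (volume.restrict Ω) ≤ _
    rw [eLpNorm_congr_ae (hc k)]
    exact eLpNorm_sub_le (ha k) (hb k) le_rfl
  refine ⟨hu.sub hv, fun k => φ k - ψ k, fun k => (hφ k).sub (hψ k), ?_, ?_⟩
  · refine key (fun k => ?_) (fun k => ?_) (fun k => ?_) hφ1 hψ1
    · exact hu.1.1.sub (hφ k).1.continuous.aestronglyMeasurable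
    · exact hv.1.1.sub (hψ k).1.continuous.aestronglyMeasurable
    · exact Eventually.of_forall fun x => by simp; ring
  · refine key (fun k => ?_) (fun k => ?_) (fun k => ?_) hφ2 hψ2
    · exact (hu.memLp_weakGrad hΩ).1.sub (measurable_gradient _).aestronglyMeasurable
    · exact (hv.memLp_weakGrad hΩ).1.sub (measurable_gradient _).aestronglyMeasurable
    · filter_upwards [hu.weakGrad_sub_ae_eq hΩ hv] with x hx
      rw [hx, gradient_sub_apply ((hφ k).1.differentiable (by simp)).differentiableAt
        ((hψ k).1.differentiable (by simp)).differentiableAt]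
      simp only [Pi.sub_apply]
      abel

theorem LipschitzWith.memW1Infty {n : ℕ} {Ω : Set (RSpace n)}
    (hb : Bornology.IsBounded Ω) {K : ℝ≥0} {w : RSpace n → ℝ} (hw : LipschitzWith K w) :
    MemW1Infty Ω w := by
  refine ⟨?_, gradient w, hw.hasWeakGradient Ω, ?_⟩
  · obtain ⟨R, hR⟩ := hb.subset_closedBall 0
    obtain ⟨C, hC⟩ := (isCompact_closedBall (0 : RSpace n) R).exists_bound_of_continuousOn
      hw.continuous.continuousOn
    refine memLp_top_of_bound hw.continuous.aestronglyMeasurable C ?_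
    refine ae_restrict_of_ae_restrict_of_subset hR ?_
    exact ae_restrict_of_forall_mem measurableSet_closedBall hC
  · exact memLp_top_of_bound (measurable_gradient w).aestronglyMeasurable K
      (Eventually.of_forall hw.norm_gradient_le)

/-! ### Mollification and Lipschitz representatives. -/

/-- The mollification of (the extension by zero of) a function on `Ω`. -/
noncomputable def mollify {n : ℕ} (Ω : Set (RSpace n)) (b : ContDiffBump (0 : RSpace n))
    (u : RSpace n → ℝ) : RSpace n → ℝ :=
  convolution (b.normed volume) (Ω.indicator u) (ContinuousLinearMap.lsmul ℝ ℝ) volume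

/-- Makes the reflected mollification kernel admissible in the definition of the weak gradient. -/
theorem isTestFunction_normed_sub {n : ℕ} {Ω : Set (RSpace n)} (b : ContDiffBump (0 : RSpace n))
    {x : RSpace n} (hx : Metric.closedBall x b.rOut ⊆ Ω) :
    IsTestFunction Ω (fun t => b.normed volume (x - t)) := by
  have hts : tsupport (fun t => b.normed volume (x - t)) ⊆ Metric.closedBall x b.rOut := by
    refine closure_minimal (fun t ht => ?_) Metric.isClosed_closedBall
    have : x - t ∈ Function.support (b.normed (volume : Measure (RSpace n))) := ht
    rw [b.support_normed_eq, mem_ball_zero_iff] at this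
    rw [Metric.mem_closedBall, dist_comm, dist_eq_norm]
    exact this.le
  refine ⟨b.contDiff_normed.comp (contDiff_const.sub contDiff_id), ?_, hts.trans hx⟩
  exact HasCompactSupport.intro' (isCompact_closedBall x b.rOut) Metric.isClosed_closedBall
    fun t ht => image_eq_zero_of_notMem_tsupport
      (f := fun t => b.normed (volume : Measure (RSpace n)) (x - t)) fun h => ht (hts h)

theorem fderiv_comp_const_sub_apply {n : ℕ} {φ : RSpace n → ℝ} (hφ : Differentiable ℝ φ)
    (x t v : RSpace n) : fderiv ℝ (fun t => φ (x - t)) t v = -fderiv ℝ φ (x - t) v := by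
  have h1 : HasFDerivAt (fun t : RSpace n => x - t)
      (-(ContinuousLinearMap.id ℝ (RSpace n))) t := (hasFDerivAt_id t).const_sub x
  have := (hφ (x - t)).hasFDerivAt.comp t h1
  rw [show (fun t => φ (x - t)) = φ ∘ fun t => x - t from rfl, this.fderiv]
  simp

theorem contDiff_mollify {n : ℕ} {Ω : Set (RSpace n)} (b : ContDiffBump (0 : RSpace n))
    {u : RSpace n → ℝ} (hu : LocallyIntegrable (Ω.indicator u) volume) :
    ContDiff ℝ ∞ (mollify Ω b u) :=
  b.hasCompactSupport_normed.contDiff_convolution_left _ (n := ⊤) b.contDiff_normed hu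

/-- The derivative falls on the kernel, and testing the weak gradient with that kernel moves it to
`u`. The kernel at `x` is supported in `Ω`, so the jump of the zero extension across the boundary
plays no role. -/
theorem inner_gradient_mollify {n : ℕ} {Ω : Set (RSpace n)} (hΩ : MeasurableSet Ω)
    (b : ContDiffBump (0 : RSpace n)) {u : RSpace n → ℝ} {G : RSpace n → RSpace n}
    (hu : LocallyIntegrable (Ω.indicator u) volume) (hG : HasWeakGradient Ω u G)
    {x : RSpace n} (hx : Metric.closedBall x b.rOut ⊆ Ω) (v : RSpace n) :
    inner ℝ v (gradient (mollify Ω b u) x)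
      = ∫ t in Ω, inner ℝ v (G t) * b.normed volume (x - t) := by
  have hφ := isTestFunction_normed_sub b hx
  have hc : ContDiff ℝ 1 (b.normed (volume : Measure (RSpace n))) := b.contDiff_normed (n := 1)
  have hd : Differentiable ℝ (b.normed (volume : Measure (RSpace n))) := hc.differentiable (by simp)
  have h1 := b.hasCompactSupport_normed.hasFDerivAt_convolution_right
    (μ := volume) (ContinuousLinearMap.lsmul ℝ ℝ).flip hu hc x
  rw [convolution_flip] at h1
  rw [inner_gradient_eq_fderiv, mollify, h1.fderiv, convolution_precompR_apply _ hu
    (b.hasCompactSupport_normed.fderiv ℝ) (hc.continuous_fderiv (by simp)), convolution]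
  have h2 := hG.3 _ hφ v
  rw [← neg_eq_iff_eq_neg] at h2
  rw [← h2, ← integral_neg, ← integral_indicator hΩ]
  refine integral_congr_ae (Eventually.of_forall fun t => ?_)
  by_cases ht : t ∈ Ω
  · simp [ht, fderiv_comp_const_sub_apply hd, mul_comm]
  · simp [ht]

theorem integral_normed_sub {n : ℕ} (b : ContDiffBump (0 : RSpace n)) (x : RSpace n) :
    ∫ t, b.normed volume (x - t) = 1 := by
  rw [integral_sub_left_eq_self (b.normed (volume : Measure (RSpace n))) volume x,
    b.integral_normed]

theorem integrable_normed_sub {n : ℕ} (b : ContDiffBump (0 : RSpace n)) (x : RSpace n) :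
    Integrable (fun t => b.normed volume (x - t)) :=
  (b.integrable_normed (μ := volume)).comp_sub_left x

theorem abs_setIntegral_mul_normed_le {n : ℕ} {Ω : Set (RSpace n)} (b : ContDiffBump (0 : RSpace n))
    {F : RSpace n → ℝ} {C : ℝ} (hC : 0 ≤ C) (hF : ∀ᵐ x ∂volume.restrict Ω, |F x| ≤ C)
    (x : RSpace n) : |∫ t in Ω, F t * b.normed volume (x - t)| ≤ C := by
  have hi := (integrable_normed_sub b x).const_mul C
  calc |∫ t in Ω, F t * b.normed volume (x - t)|
      ≤ ∫ t in Ω, C * b.normed volume (x - t) := by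
        rw [← Real.norm_eq_abs]
        refine norm_integral_le_of_norm_le hi.integrableOn ?_
        filter_upwards [hF] with t ht
        rw [norm_mul, Real.norm_eq_abs, Real.norm_of_nonneg (b.nonneg_normed _)]
        exact mul_le_mul_of_nonneg_right ht (b.nonneg_normed _)
    _ ≤ ∫ t, C * b.normed volume (x - t) := by
        refine setIntegral_le_integral hi (Eventually.of_forall fun t => ?_)
        exact mul_nonneg hC (b.nonneg_normed _)
    _ = C := by rw [integral_const_mul, integral_normed_sub, mul_one]

theorem norm_gradient_mollify_le {n : ℕ} {Ω : Set (RSpace n)} (hΩ : MeasurableSet Ω)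
    (b : ContDiffBump (0 : RSpace n)) {u : RSpace n → ℝ} {G : RSpace n → RSpace n}
    (hu : LocallyIntegrable (Ω.indicator u) volume) (hG : HasWeakGradient Ω u G) {L : ℝ≥0}
    (hL : ∀ᵐ x ∂volume.restrict Ω, ‖G x‖ ≤ L)
    {x : RSpace n} (hx : Metric.closedBall x b.rOut ⊆ Ω) :
    ‖gradient (mollify Ω b u) x‖ ≤ L := by
  -- Testing in the direction `g` itself yields `‖g‖² ≤ ‖g‖ L`.
  set g := gradient (mollify Ω b u) x with hg
  have h := inner_gradient_mollify hΩ b hu hG hx g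
  have h2 : |∫ t in Ω, inner ℝ g (G t) * b.normed volume (x - t)| ≤ ‖g‖ * L := by
    refine abs_setIntegral_mul_normed_le b (by positivity) ?_ x
    filter_upwards [hL] with t ht
    exact (abs_real_inner_le_norm _ _).trans (by gcongr)
  rw [← h, ← hg, real_inner_self_eq_norm_sq, abs_of_nonneg (by positivity), sq] at h2
  by_contra! hlt
  have : 0 < ‖g‖ := L.2.trans_lt hlt
  nlinarith

theorem abs_mollify_le {n : ℕ} {Ω : Set (RSpace n)} (hΩ : MeasurableSet Ω)
    (b : ContDiffBump (0 : RSpace n)) {u : RSpace n → ℝ} {C : ℝ} (hC : 0 ≤ C)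
    (hu : ∀ᵐ x ∂volume.restrict Ω, |u x| ≤ C) (x : RSpace n) : |mollify Ω b u x| ≤ C := by
  have h := abs_setIntegral_mul_normed_le b hC hu x
  have e : mollify Ω b u x = ∫ t in Ω, u t * b.normed volume (x - t) := by
    rw [mollify, convolution_eq_swap, ← integral_indicator hΩ]
    refine integral_congr_ae (Eventually.of_forall fun t => ?_)
    by_cases ht : t ∈ Ω <;> simp [ht, mul_comm]
  rwa [e]

/-- A sequence of bump functions at the origin with radii `1 / (2 (k + 1))` and `1 / (k + 1)`. -/
noncomputable def bumpSeq (n k : ℕ) : ContDiffBump (0 : RSpace n) where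
  rIn := 1 / (2 * ((k : ℝ) + 1))
  rOut := 1 / ((k : ℝ) + 1)
  rIn_pos := by positivity
  rIn_lt_rOut := by
    apply one_div_lt_one_div_of_lt (by positivity)
    have : (0 : ℝ) ≤ k := k.cast_nonneg
    linarith

theorem tendsto_rOut_bumpSeq (n : ℕ) : Tendsto (fun k => (bumpSeq n k).rOut) atTop (𝓝 0) :=
  tendsto_one_div_add_atTop_nhds_zero_nat

/-- A bounded ratio of radii is what the a.e. convergence of mollifications of locally integrable
functions requires. -/
theorem rOut_bumpSeq_le (n k : ℕ) : (bumpSeq n k).rOut ≤ 2 * (bumpSeq n k).rIn := by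
  simp only [bumpSeq]
  apply le_of_eq
  field_simp

theorem MeasureTheory.MemLp.exists_ae_norm_le {α E : Type*} [MeasurableSpace α]
    [NormedAddCommGroup E] {μ : Measure α} {u : α → E} (hu : MemLp u ∞ μ) :
    ∃ C : ℝ, 0 ≤ C ∧ ∀ᵐ x ∂μ, ‖u x‖ ≤ C := by
  refine ⟨(eLpNormEssSup u μ).toReal, ENNReal.toReal_nonneg, ?_⟩
  have hfin : eLpNormEssSup u μ ≠ ⊤ := by
    have := hu.2.ne
    rwa [eLpNorm_exponent_top] at this
  filter_upwards [ae_le_eLpNormEssSup (f := u) (μ := μ)] with x hx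
  simpa using ENNReal.toReal_mono hfin hx

/-- A function of class `W^{1,∞}` has a representative that is Lipschitz on the balls contained
in `Ω`. -/
theorem HasWeakGradient.exists_lipschitz_representative {n : ℕ} {Ω : Set (RSpace n)}
    (hΩ : IsOpen Ω) {u : RSpace n → ℝ} {G : RSpace n → RSpace n}
    (hu : MemLp u ∞ (volume.restrict Ω)) (hG : HasWeakGradient Ω u G) {L : ℝ≥0}
    (hL : ∀ᵐ x ∂volume.restrict Ω, ‖G x‖ ≤ L) :
    ∃ w : RSpace n → ℝ, w =ᵐ[volume.restrict Ω] u ∧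
      ∀ x r, Metric.closedBall x r ⊆ Ω → LipschitzOnWith L w (Metric.closedBall x r) := by
  have hli : LocallyIntegrable (Ω.indicator u) volume :=
    ((memLp_indicator_iff_restrict hΩ.measurableSet).2 hu).locallyIntegrable (by simp)
  obtain ⟨C, hC0, hC⟩ := hu.exists_ae_norm_le
  set F : ℕ → RSpace n → ℝ := fun k => mollify Ω (bumpSeq n k) u with hF
  have hFb : ∀ k x, |F k x| ≤ C := fun k x => abs_mollify_le hΩ.measurableSet _ hC0 hC x
  have hb1 : ∀ x, IsBoundedUnder (· ≥ ·) atTop fun k => F k x := fun x =>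
    isBoundedUnder_of ⟨-C, fun k => (abs_le.1 (hFb k x)).1⟩
  have hb2 : ∀ x, IsBoundedUnder (· ≤ ·) atTop fun k => F k x := fun x =>
    isBoundedUnder_of ⟨C, fun k => (abs_le.1 (hFb k x)).2⟩
  -- The `liminf` is defined at every point and agrees with `u` wherever the mollifications converge
  -- to it. The Lipschitz bounds, valid on a fixed ball for large `k`, pass to it.
  refine ⟨fun x => liminf (fun k => F k x) atTop, ?_, fun x r hr => ?_⟩
  · have h := ContDiffBump.ae_convolution_tendsto_right_of_locallyIntegrable
      (tendsto_rOut_bumpSeq n) (Eventually.of_forall (rOut_bumpSeq_le n)) hli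
    rw [Filter.EventuallyEq, ae_restrict_iff' hΩ.measurableSet]
    filter_upwards [h] with x hx hxΩ
    rw [indicator_of_mem hxΩ] at hx
    exact hx.liminf_eq
  · obtain ⟨δ, hδ, hδΩ⟩ := (isCompact_closedBall x r).exists_cthickening_subset_open hΩ hr
    have hk : ∀ᶠ k in atTop, LipschitzOnWith L (F k) (Metric.closedBall x r) := by
      filter_upwards [(tendsto_rOut_bumpSeq n).eventually_lt_const hδ] with k hk
      refine Convex.lipschitzOnWith_of_nnnorm_fderiv_le (𝕜 := ℝ)
        (fun y _ => ((contDiff_mollify _ hli).differentiable (by simp)) y) (fun y hy => ?_)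
        (convex_closedBall x r)
      have hsub : Metric.closedBall y (bumpSeq n k).rOut ⊆ Ω := by
        refine Subset.trans ?_ hδΩ
        exact (Metric.closedBall_subset_closedBall hk.le).trans
          (Metric.closedBall_subset_cthickening hy δ)
      have := norm_gradient_mollify_le hΩ.measurableSet (bumpSeq n k) hli hG hL hsub
      rw [gradient, LinearIsometryEquiv.norm_map] at this
      exact this
    refine LipschitzOnWith.of_le_add_mul L fun y hy z hz => ?_
    rw [← liminf_add_const atTop (fun k => F k z) (L * dist y z)
      (hb2 z).isCoboundedUnder_ge (hb1 z)]
    refine liminf_le_liminf ?_ (hb1 y) ?_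
    · filter_upwards [hk] with k hk
      exact hk.le_add_mul hy hz
    · refine IsBoundedUnder.isCoboundedUnder_ge (isBoundedUnder_of ⟨C + L * dist y z, fun k => ?_⟩)
      have := (abs_le.1 (hFb k z)).2
      linarith

/-- A function that is Lipschitz on the balls contained in the open set `Ω` is differentiable almost
everywhere in `Ω`, and its gradient is the weak gradient. -/
theorem HasWeakGradient.ae_hasGradientAt {n : ℕ} {Ω : Set (RSpace n)}
    (hΩ : IsOpen Ω) {u : RSpace n → ℝ} {G : RSpace n → RSpace n} (hG : HasWeakGradient Ω u G)
    {L : ℝ≥0} (hL : ∀ x r, Metric.closedBall x r ⊆ Ω → LipschitzOnWith L u (Metric.closedBall x r)) :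
    ∀ᵐ x ∂volume.restrict Ω, HasGradientAt u (G x) x := by
  have hloc : ∀ x ∈ Ω, ∃ r > 0, Metric.ball x r ⊆ Ω ∧
      ∀ᵐ y ∂volume.restrict (Metric.ball x r), HasGradientAt u (G y) y := by
    intro x hx
    obtain ⟨r, hr, hrΩ⟩ := Metric.nhds_basis_closedBall.mem_iff.1 (hΩ.mem_nhds hx)
    have hball : Metric.ball x r ⊆ Ω := Metric.ball_subset_closedBall.trans hrΩ
    refine ⟨r, hr, hball, ?_⟩
    -- A global Lipschitz extension gives access to Rademacher's theorem; uniqueness of weak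
    -- gradients identifies its gradient with `G` on the ball.
    obtain ⟨U, hU, hUu⟩ := (hL x r hrΩ).extend_real
    have heq : u =ᵐ[volume.restrict (Metric.ball x r)] U :=
      ae_restrict_of_forall_mem measurableSet_ball fun y hy =>
        hUu (Metric.ball_subset_closedBall hy)
    have h1 := ((hG.mono hball).congr heq).ae_eq Metric.isOpen_ball (hU.hasWeakGradient _)
    have h2 : ∀ᵐ y ∂volume.restrict (Metric.ball x r), DifferentiableAt ℝ U y :=
      ae_restrict_of_ae hU.ae_differentiableAt
    filter_upwards [h1, h2, ae_restrict_mem measurableSet_ball] with y hy1 hy2 hy3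
    rw [hy1]
    refine hy2.hasGradientAt.congr_of_eventuallyEq ?_
    filter_upwards [Metric.isOpen_ball.mem_nhds hy3] with z hz
    exact hUu (Metric.ball_subset_closedBall hz)
  choose! r hr hrΩ hae using hloc
  obtain ⟨T, hTΩ, hT, hcov⟩ := TopologicalSpace.countable_cover_nhdsWithin
    (f := fun x => Metric.ball x (r x)) (s := Ω)
    (fun x hx => mem_nhdsWithin_of_mem_nhds (Metric.ball_mem_nhds x (hr x hx)))
  have : ∀ᵐ y ∂volume.restrict (⋃ x ∈ T, Metric.ball x (r x)), HasGradientAt u (G y) y :=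
    (ae_restrict_biUnion_iff _ hT _).2 fun x hx => hae x (hTΩ hx)
  exact ae_restrict_of_ae_restrict_of_subset hcov this

/-! ### Lipschitz functions vanishing outside `Ω` belong to `W_0^{1,∞}(Ω)`. -/

/-- No differentiability is needed, since `gradient` takes the value `0` where the derivative does
not exist. -/
theorem IsLocalMin.gradient_eq_zero {n : ℕ} {w : RSpace n → ℝ} {x : RSpace n}
    (h : IsLocalMin w x) : gradient w x = 0 := by
  rw [gradient, h.fderiv_eq_zero, map_zero]

theorem tendsto_eLpNorm_one_of_bounded {α E : Type*} [MeasurableSpace α] [NormedAddCommGroup E]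
    {μ : Measure α} [IsFiniteMeasure μ] {f : ℕ → α → E}
    (hf : ∀ k, AEStronglyMeasurable (f k) μ) {C : ℝ≥0} (hC : ∀ k, ∀ᵐ x ∂μ, ‖f k x‖ ≤ C)
    (h : ∀ᵐ x ∂μ, Tendsto (fun k => f k x) atTop (𝓝 0)) :
    Tendsto (fun k => eLpNorm (f k) 1 μ) atTop (𝓝 0) := by
  simp_rw [eLpNorm_one_eq_lintegral_enorm]
  have := tendsto_lintegral_of_dominated_convergence' (μ := μ) (F := fun k x => ‖f k x‖ₑ)
    (f := fun _ => 0) (fun _ => (C : ℝ≥0∞)) (fun k => (hf k).enorm) (fun k => ?_) ?_ ?_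
  · simpa using this
  · filter_upwards [hC k] with x hx
    rw [enorm_eq_nnnorm]
    exact_mod_cast hx
  · rw [lintegral_const]
    exact ENNReal.mul_ne_top ENNReal.coe_ne_top (measure_ne_top μ _)
  · filter_upwards [h] with x hx
    simpa [Function.comp_def] using (continuous_enorm.tendsto (0 : E)).comp hx

theorem LipschitzWith.locallyIntegrable_gradient {n : ℕ} {K : ℝ≥0} {w : RSpace n → ℝ}
    (hw : LipschitzWith K w) : LocallyIntegrable (gradient w) volume :=
  locallyIntegrableOn_univ.1 (hw.hasWeakGradient univ).2

/-- Turns a.e. convergence of mollified gradients into the convergence theorem for mollifications,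
applied to `gradient w`. -/
theorem LipschitzWith.gradient_mollify {n : ℕ} {K : ℝ≥0} {w : RSpace n → ℝ}
    (hw : LipschitzWith K w) (b : ContDiffBump (0 : RSpace n)) :
    gradient (mollify univ b w) = convolution (b.normed volume) (gradient w)
      (ContinuousLinearMap.lsmul ℝ ℝ) volume := by
  have hli : LocallyIntegrable ((univ : Set (RSpace n)).indicator w) volume := by
    rw [indicator_univ]
    exact hw.continuous.locallyIntegrable
  ext1 x
  refine ext_inner_left ℝ fun v => ?_
  rw [inner_gradient_mollify MeasurableSet.univ b hli (hw.hasWeakGradient univ) (subset_univ _) v,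
    convolution_eq_swap, setIntegral_univ]
  simp only [ContinuousLinearMap.lsmul_apply]
  rw [← integral_inner]
  · refine integral_congr_ae (Eventually.of_forall fun t => ?_)
    simp only [inner_smul_right]
    rw [mul_comm]
  · exact (integrable_normed_sub b x).smul_bdd K
      (measurable_gradient w).aestronglyMeasurable (Eventually.of_forall hw.norm_gradient_le)

theorem LipschitzWith.exists_testFunction_approx {n : ℕ} {Ω : Set (RSpace n)} (hΩ : IsOpen Ω)
    (hb : Bornology.IsBounded Ω) {K : ℝ≥0} {w : RSpace n → ℝ} (hw : LipschitzWith K w)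
    (hc : HasCompactSupport w) (hs : tsupport w ⊆ Ω) {ε : ℝ≥0∞} (hε : 0 < ε) :
    ∃ φ, IsTestFunction Ω φ ∧ eLpNorm (w - φ) 1 (volume.restrict Ω) < ε ∧
      eLpNorm (gradient w - gradient φ) 1 (volume.restrict Ω) < ε := by
  have : IsFiniteMeasure (volume.restrict Ω) :=
    ⟨by rw [Measure.restrict_apply_univ]; exact hb.measure_lt_top⟩
  have hli : LocallyIntegrable ((univ : Set (RSpace n)).indicator w) volume := by
    rw [indicator_univ]
    exact hw.continuous.locallyIntegrable
  set F : ℕ → RSpace n → ℝ := fun k => mollify univ (bumpSeq n k) w with hF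
  have hFs : ∀ k, ContDiff ℝ ∞ (F k) := fun k => contDiff_mollify _ hli
  obtain ⟨C, hC⟩ := hw.continuous.bounded_above_of_compact_support hc
  have hC0 : 0 ≤ C := (norm_nonneg _).trans (hC 0)
  have t1 : Tendsto (fun k => eLpNorm (w - F k) 1 (volume.restrict Ω)) atTop (𝓝 0) := by
    refine tendsto_eLpNorm_one_of_bounded (C := ⟨C + C, by positivity⟩)
      (fun k => (hw.continuous.sub (hFs k).continuous).aestronglyMeasurable)
      (fun k => Eventually.of_forall fun x => ?_) (Eventually.of_forall fun x => ?_)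
    · exact (_root_.norm_sub_le _ _).trans (add_le_add (hC x)
        (abs_mollify_le MeasurableSet.univ _ hC0 (Eventually.of_forall hC) x))
    · have := ContDiffBump.convolution_tendsto_right_of_continuous (μ := volume)
        (tendsto_rOut_bumpSeq n) hw.continuous x
      have h2 := (tendsto_const_nhds (x := w x)).sub this
      simpa [hF, mollify] using h2
  have t2 : Tendsto (fun k => eLpNorm (gradient w - gradient (F k)) 1 (volume.restrict Ω)) atTop
      (𝓝 0) := by
    refine tendsto_eLpNorm_one_of_bounded (C := K + K)
      (fun k => ((measurable_gradient w).sub (measurable_gradient _)).aestronglyMeasurable)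
      (fun k => Eventually.of_forall fun x => ?_) (ae_restrict_of_ae ?_)
    · refine (_root_.norm_sub_le _ _).trans (add_le_add (hw.norm_gradient_le x) ?_)
      exact norm_gradient_mollify_le MeasurableSet.univ _ hli (hw.hasWeakGradient univ)
        (Eventually.of_forall hw.norm_gradient_le) (subset_univ _)
    · have := ContDiffBump.ae_convolution_tendsto_right_of_locallyIntegrable
        (tendsto_rOut_bumpSeq n) (Eventually.of_forall (rOut_bumpSeq_le n))
        hw.locallyIntegrable_gradient
      filter_upwards [this] with x hx
      have h2 := (tendsto_const_nhds (x := gradient w x)).sub hx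
      rw [sub_self] at h2
      refine h2.congr fun k => ?_
      rw [Pi.sub_apply, hF]
      simp only
      rw [hw.gradient_mollify]
  obtain ⟨δ, hδ, hδΩ⟩ := hc.isCompact.exists_cthickening_subset_open hΩ hs
  obtain ⟨k, hk, hk1, hk2⟩ := ((tendsto_rOut_bumpSeq n).eventually_lt_const hδ |>.and
    ((t1.eventually_lt_const hε).and (t2.eventually_lt_const hε))).exists
  have hsupp : Function.support (F k) ⊆ Metric.cthickening δ (tsupport w) := by
    refine (support_convolution_subset_swap _).trans ?_
    rintro _ ⟨a, ha, y, hy, rfl⟩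
    rw [indicator_univ] at ha
    rw [ContDiffBump.support_normed_eq, mem_ball_zero_iff] at hy
    refine Metric.mem_cthickening_of_dist_le _ a δ _ (subset_tsupport _ ha) ?_
    rw [dist_eq_norm]
    simpa using (hy.trans hk).le
  have hts : tsupport (F k) ⊆ Metric.cthickening δ (tsupport w) :=
    closure_minimal hsupp Metric.isClosed_cthickening
  exact ⟨F k, ⟨hFs k, HasCompactSupport.intro' hc.isCompact.cthickening
    Metric.isClosed_cthickening fun x hx => by_contra fun h => hx (hsupp h), hts.trans hδΩ⟩,
    hk1, hk2⟩

/-- A nonnegative Lipschitz function that vanishes outside the bounded open set `Ω` belongs to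
`W_0^{1,∞}(Ω)`. -/
theorem LipschitzWith.memW1InftyZero {n : ℕ} {Ω : Set (RSpace n)} (hΩ : IsOpen Ω)
    (hb : Bornology.IsBounded Ω) {K : ℝ≥0} {w : RSpace n → ℝ} (hw : LipschitzWith K w)
    (h0 : ∀ x, 0 ≤ w x) (hz : ∀ x ∉ Ω, w x = 0) : MemW1InftyZero Ω w := by
  have : IsFiniteMeasure (volume.restrict Ω) :=
    ⟨by rw [Measure.restrict_apply_univ]; exact hb.measure_lt_top⟩
  -- Lowering `w` by `1 / (k + 1)` and truncating at `0` gives a support inside `{w ≥ 1 / (k + 1)}`,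
  -- a compact subset of `Ω`; this can then be mollified.
  set g : ℕ → RSpace n → ℝ := fun k x => max (w x - 1 / ((k : ℝ) + 1)) 0 with hg
  have hpos : ∀ k : ℕ, 0 < 1 / ((k : ℝ) + 1) := fun k => by positivity
  have hgL : ∀ k, LipschitzWith K (g k) := by
    intro k
    have h := (hw.sub (LipschitzWith.const (1 / ((k : ℝ) + 1)))).max_const 0
    rwa [add_zero] at h
  have hsub : ∀ k, Function.support (g k) ⊆ {x | 1 / ((k : ℝ) + 1) ≤ w x} := by
    intro k x hx
    by_contra h
    rw [mem_ofPred_eq, not_le] at h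
    exact hx (max_eq_right (by linarith))
  have hcl : ∀ k : ℕ, IsClosed {x | 1 / ((k : ℝ) + 1) ≤ w x} := fun k =>
    isClosed_le continuous_const hw.continuous
  have hΩsub : ∀ k : ℕ, {x | 1 / ((k : ℝ) + 1) ≤ w x} ⊆ Ω := by
    intro k x hx
    by_contra h
    have := hpos k
    rw [mem_ofPred_eq, hz x h] at hx
    linarith
  have hcomp : ∀ k : ℕ, IsCompact {x | 1 / ((k : ℝ) + 1) ≤ w x} := fun k =>
    Metric.isCompact_of_isClosed_isBounded (hcl k) (hb.subset (hΩsub k))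
  have hgc : ∀ k, HasCompactSupport (g k) := fun k =>
    HasCompactSupport.intro' (hcomp k) (hcl k) fun x hx => by_contra fun h => hx (hsub k h)
  have hgs : ∀ k, tsupport (g k) ⊆ Ω := fun k =>
    (closure_minimal (hsub k) (hcl k)).trans (hΩsub k)
  choose φ hφ hφ1 hφ2 using fun k : ℕ => (hgL k).exists_testFunction_approx hΩ hb (hgc k) (hgs k)
    (ε := ((k : ℝ≥0∞) + 1)⁻¹) (by simp)
  have hε : Tendsto (fun k : ℕ => ((k : ℝ≥0∞) + 1)⁻¹) atTop (𝓝 0) := by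
    have := ENNReal.tendsto_inv_nat_nhds_zero.comp (tendsto_add_atTop_nat 1)
    simpa [Function.comp_def] using this
  have key : ∀ {E : Type} [NormedAddCommGroup E] {a b c : ℕ → RSpace n → E},
      (∀ k, AEStronglyMeasurable (a k) (volume.restrict Ω)) →
      (∀ k, AEStronglyMeasurable (b k) (volume.restrict Ω)) →
      (∀ k, c k =ᵐ[volume.restrict Ω] a k + b k) →
      Tendsto (fun k => eLpNorm (a k) 1 (volume.restrict Ω)) atTop (𝓝 0) →
      (∀ k, eLpNorm (b k) 1 (volume.restrict Ω) < ((k : ℝ≥0∞) + 1)⁻¹) →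
      Tendsto (fun k => eLpNorm (c k) 1 (volume.restrict Ω)) atTop (𝓝 0) := by
    intro E _ a b c ha hb' hc h1 h2
    have h3 := h1.add hε
    rw [add_zero] at h3
    refine tendsto_of_tendsto_of_tendsto_of_le_of_le tendsto_const_nhds h3
      (fun k => zero_le) fun k => ?_
    show eLpNorm (c k) 1 (volume.restrict Ω) ≤ _
    rw [eLpNorm_congr_ae (hc k)]
    exact (eLpNorm_add_le (ha k) (hb' k) le_rfl).trans (by gcongr; exact (h2 k).le)
  have hwg : ∀ k x, ‖w x - g k x‖ ≤ 1 / ((k : ℝ) + 1) := by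
    intro k x
    have h1 := hpos k
    have h2 := h0 x
    rw [Real.norm_eq_abs, abs_le]
    simp only [hg]
    rcases max_cases (w x - 1 / ((k : ℝ) + 1)) 0 with ⟨h, h'⟩ | ⟨h, h'⟩ <;> rw [h] <;>
      constructor <;> linarith
  refine ⟨hw.memW1Infty hb, φ, hφ, ?_, ?_⟩
  · refine key (a := fun k => w - g k) (b := fun k => g k - φ k)
      (fun k => (hw.continuous.sub (hgL k).continuous).aestronglyMeasurable)
      (fun k => ((hgL k).continuous.sub (hφ k).1.continuous).aestronglyMeasurable)
      (fun k => Eventually.of_forall fun x => by simp) ?_ hφ1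
    refine tendsto_eLpNorm_one_of_bounded (C := 1)
      (fun k => (hw.continuous.sub (hgL k).continuous).aestronglyMeasurable)
      (fun k => Eventually.of_forall fun x => ?_) (Eventually.of_forall fun x => ?_)
    · refine (hwg k x).trans ?_
      rw [NNReal.coe_one, div_le_one (by positivity)]
      have : (0 : ℝ) ≤ k := k.cast_nonneg
      linarith
    · exact squeeze_zero_norm (fun k => hwg k x) tendsto_one_div_add_atTop_nhds_zero_nat
  · refine key (a := fun k => gradient w - gradient (g k))
      (b := fun k => gradient (g k) - gradient (φ k))
      (fun k => ((measurable_gradient _).sub (measurable_gradient _)).aestronglyMeasurable)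
      (fun k => ((measurable_gradient _).sub (measurable_gradient _)).aestronglyMeasurable)
      (fun k => ?_) ?_ hφ2
    · filter_upwards [weakGrad_ae_eq hΩ (hw.hasWeakGradient Ω)] with x hx
      simp [hx]
    refine tendsto_eLpNorm_one_of_bounded (C := K + K)
      (fun k => ((measurable_gradient _).sub (measurable_gradient _)).aestronglyMeasurable)
      (fun k => Eventually.of_forall fun x => ?_) (Eventually.of_forall fun x => ?_)
    · exact (_root_.norm_sub_le _ _).trans
        (add_le_add (hw.norm_gradient_le x) ((hgL k).norm_gradient_le x))
    -- Where `w` vanishes, both `w` and `g k` have a minimum, so both gradients are `0`. Where `w`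
    -- is positive, `g k` eventually differs from `w` by a constant near `x`.
    · rcases (h0 x).eq_or_lt with hx | hx
      · have h1 : gradient w x = 0 := by
          refine IsLocalMin.gradient_eq_zero (Eventually.of_forall fun y => ?_)
          rw [← hx]
          exact h0 y
        have h2 : ∀ k, gradient (g k) x = 0 := by
          intro k
          refine IsLocalMin.gradient_eq_zero (Eventually.of_forall fun y => ?_)
          have : g k x = 0 := max_eq_right (by rw [← hx]; linarith [hpos k])
          rw [this]
          exact le_max_right _ _
        simp [h1, h2]
      · have hev := (tendsto_one_div_add_atTop_nhds_zero_nat (𝕜 := ℝ)).eventually_lt_const hx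
        refine tendsto_const_nhds.congr' ?_
        filter_upwards [hev] with k hk
        have : g k =ᶠ[𝓝 x] fun y => w y - 1 / ((k : ℝ) + 1) := by
          filter_upwards [hw.continuous.continuousAt.eventually_const_lt hk] with y hy
          exact max_eq_left (by linarith)
        rw [Pi.sub_apply, this.gradient_eq, gradient, gradient, fderiv_sub_const, sub_self]

/-! ### Local corrections by cones and the Vitali covering. -/

/-- `w` is supported in a ball `B(x₀, r) ⊆ Ω`, and where `w` is positive, `u - w` is locally a
translate of `H` up to a constant; the set where `w` is positive is comparable with the ball. -/
structure IsLocalCorrection {n : ℕ} (Ω : Set (RSpace n)) (u H : RSpace n → ℝ) (K C : ℝ≥0)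
    (x₀ : RSpace n) (r : ℝ) (w : RSpace n → ℝ) : Prop where
  lipschitz : LipschitzWith K w
  nonneg : ∀ x, 0 ≤ w x
  le : ∀ x, w x ≤ K * r
  subset_closedBall : {x | 0 < w x} ⊆ Metric.closedBall x₀ r
  closedBall_subset : Metric.closedBall x₀ r ⊆ Ω
  nonempty : {x | 0 < w x}.Nonempty
  volume_le : volume (Metric.closedBall x₀ (3 * r)) ≤ C * volume (closure {x | 0 < w x})
  volume_closure_diff : volume (closure {x | 0 < w x} \ {x | 0 < w x}) = 0
  eventuallyEq : ∀ x, 0 < w x → ∃ b, (fun y => u y - w y) =ᶠ[𝓝 x] fun y => H (y - x₀) + b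

/-- Only countably many level sets can have positive measure. -/
theorem exists_mem_Ioo_volume_eq_zero {n : ℕ} {g : RSpace n → ℝ} (hg : Measurable g) {a b : ℝ}
    (hab : a < b) : ∃ t ∈ Ioo a b, volume {x | g x = t} = 0 := by
  have h := (Measure.countable_meas_level_set_pos (μ := volume) hg).dense_compl ℝ
  obtain ⟨t, ht, htab⟩ := h.exists_between hab
  exact ⟨t, htab, by simpa using ht⟩

/-- The correction is the positive part of `u - H (· - x₀) - t`, cut off away from `x₀`. `K` and `C`
are chosen before the point and the radius: the covering needs a uniform `C`, the weak-* convergence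
a uniform `K`. -/
theorem exists_isLocalCorrection {n : ℕ} {L L₀ : ℝ≥0} {δ : ℝ} (hδ : 0 < δ) {H : RSpace n → ℝ}
    (hH : LipschitzWith L₀ H) (hH0 : H 0 = 0) :
    ∃ K C : ℝ≥0, ∀ (Ω : Set (RSpace n)) (u : RSpace n → ℝ) (x₀ ζ : RSpace n) (r₀ : ℝ), 0 < r₀ →
      Metric.closedBall x₀ r₀ ⊆ Ω → LipschitzOnWith L u (Metric.closedBall x₀ r₀) →
      HasGradientAt u ζ x₀ → (∀ x, inner ℝ ζ x + δ * ‖x‖ ≤ H x) →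
      ∀ η : ℝ, 0 < η → ∃ r w, r ≤ η ∧ IsLocalCorrection Ω u H K C x₀ r w := by
  set Q : ℝ≥0 := L + L₀ with hQ
  -- Chosen so that `q x₀ > δ r / 4` and the Lipschitz constant `Q` force `q > 0` on the ball of
  -- radius `κ r`.
  set κ : ℝ := δ / (4 * (Q + δ)) with hκ
  have hQ0 : (0 : ℝ) ≤ Q := Q.2
  have hκ0 : 0 < κ := by positivity
  have hκQ : κ * (4 * (Q + δ)) = δ := by rw [hκ]; field_simp
  have hκ1 : κ < 1 := by nlinarith [mul_nonneg hκ0.le hQ0]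
  have hκQ' : κ * Q < δ / 4 := by nlinarith
  -- With this slope the cutoff `m` is at least `(δ + Q) r`, hence above `q`, for `‖y - x₀‖ ≤ 2 r /
  -- 3`.
  set M : ℝ≥0 := 3 * (⟨δ, hδ.le⟩ + Q) with hM
  have hMr : (M : ℝ) = 3 * (δ + Q) := by rw [hM]; push_cast; rfl
  refine ⟨M, ((3 / κ) ^ n).toNNReal, fun Ω u x₀ ζ r₀ hr₀ hΩ hu hζ hζH η hη => ?_⟩
  obtain ⟨U, hU, hUu⟩ := hu.extend_real
  obtain ⟨ρ, hρ, hρu⟩ := Metric.eventually_nhds_iff.1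
    ((hasGradientAt_iff_isLittleO.1 hζ).def (show 0 < δ / 4 by positivity))
  set r : ℝ := min (min r₀ η) (ρ / 2) with hr
  have hr0 : 0 < r := by positivity
  have hrr₀ : r ≤ r₀ := (min_le_left _ _).trans (min_le_left _ _)
  have hrη : r ≤ η := (min_le_left _ _).trans (min_le_right _ _)
  have hrρ : r < ρ := (min_le_right _ _).trans_lt (by linarith)
  have hball : Metric.closedBall x₀ r ⊆ Metric.closedBall x₀ r₀ :=
    Metric.closedBall_subset_closedBall hrr₀
  have hHx₀ : LipschitzWith L₀ fun y => H (y - x₀) := by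
    have := hH.comp ((LipschitzWith.id (α := RSpace n)).sub (LipschitzWith.const x₀))
    simpa [Function.comp_def] using this
  -- The upper bound on `t` makes `q x₀ > δ r / 4`; the lower bound makes `q` negative on the
  -- annulus `2 r / 3 ≤ ‖y - x₀‖ ≤ r`. The null level set makes the boundary of `{w > 0}`
  -- negligible.
  obtain ⟨t, ⟨ht1, ht2⟩, htn⟩ := exists_mem_Ioo_volume_eq_zero
    (g := fun y => U y - H (y - x₀)) (hU.continuous.sub hHx₀.continuous).measurable
    (show u x₀ - δ * r / 2 < u x₀ - δ * r / 4 by nlinarith [mul_pos hδ hr0])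
  have hUx₀ : U x₀ = u x₀ := (hUu (Metric.mem_closedBall_self hr₀.le)).symm
  set q : RSpace n → ℝ := fun y => U y - H (y - x₀) - t with hq
  have hqL : LipschitzWith Q q := by
    have := (hU.sub hHx₀).sub (LipschitzWith.const t)
    rwa [add_zero] at this
  have hqx₀ : q x₀ = u x₀ - t := by simp [hq, hUx₀, hH0]
  have hq_le : ∀ y, q y ≤ q x₀ + Q * ‖y - x₀‖ := fun y => by
    have := hqL.le_add_mul y x₀
    rwa [dist_eq_norm] at this
  have hq_ge : ∀ y, q x₀ - Q * ‖y - x₀‖ ≤ q y := fun y => by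
    have := hqL.le_add_mul x₀ y
    rw [dist_comm, dist_eq_norm] at this
    linarith
  set m : RSpace n → ℝ := fun y => M * (r - ‖y - x₀‖) with hm
  have hmL : LipschitzWith M m := by
    refine LipschitzWith.of_le_add_mul M fun y z => ?_
    have h1 : ‖z - x₀‖ ≤ ‖y - x₀‖ + dist y z := by
      rw [dist_comm, dist_eq_norm]
      calc ‖z - x₀‖ = ‖(y - x₀) + (z - y)‖ := by congr 1; abel
        _ ≤ _ := norm_add_le _ _
    have := mul_le_mul_of_nonneg_left h1 M.2
    simp only [hm]
    change (M : ℝ) * _ ≤ M * _ at this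
    nlinarith
  -- Differentiability costs at most `δ/4 ‖y - x₀‖` and the margin gains `δ ‖y - x₀‖`; the net `3δ/4
  -- · 2r/3 = δ r / 2` brings `u - H (· - x₀)` below `t`.
  have hq_neg : ∀ y, ‖y - x₀‖ ≤ r → 2 * r / 3 ≤ ‖y - x₀‖ → q y < 0 := by
    intro y hy1 hy2
    have h1 := hρu (y := y) (by rw [dist_eq_norm]; linarith)
    have h2 := hζH (y - x₀)
    have h3 : U y = u y := (hUu (hball (by rwa [Metric.mem_closedBall, dist_eq_norm]))).symm
    rw [Real.norm_eq_abs] at h1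
    have h4 := (abs_le.1 h1).2
    simp only [hq, h3]
    nlinarith [mul_le_mul_of_nonneg_left hy2 hδ.le]
  set w : RSpace n → ℝ := fun y => max (min (q y) (m y)) 0 with hw
  have hMpos : (0 : ℝ) < M := by rw [hMr]; positivity
  have hpos : ∀ y, 0 < w y ↔ 0 < q y ∧ 0 < m y := fun y => by simp [hw]
  have hm_pos : ∀ y, 0 < m y ↔ ‖y - x₀‖ < r := fun y => by
    simp only [hm]
    rw [mul_pos_iff_of_pos_left hMpos, sub_pos]
  have hpos_lt : ∀ y, 0 < w y → ‖y - x₀‖ < 2 * r / 3 := fun y hy => by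
    by_contra! h
    have h1 := (hpos y).1 hy
    exact lt_asymm h1.1 (hq_neg y ((hm_pos y).1 h1.2).le h)
  have hwL : LipschitzWith M w := by
    have h1 : LipschitzWith M q := hqL.weaken (by
      rw [← NNReal.coe_le_coe, hMr]; nlinarith)
    have := (h1.min hmL).max_const 0
    rwa [max_self] at this
  have hwq : ∀ y, 0 < w y → w y = q y := by
    intro y hy
    have h1 := hpos_lt y hy
    have h2 : q y ≤ m y := by
      have h3 := hq_le y
      have h4 : (Q : ℝ) * ‖y - x₀‖ ≤ Q * r := mul_le_mul_of_nonneg_left (by linarith) hQ0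
      simp only [hm]
      rw [hMr]
      nlinarith [mul_pos hδ hr0, mul_pos hMpos hr0]
    simp only [hw]
    rw [min_eq_left h2, max_eq_left ((hpos y).1 hy).1.le]
  have hin : Metric.closedBall x₀ (κ * r) ⊆ {x | 0 < w x} := by
    intro y hy
    rw [Metric.mem_closedBall, dist_eq_norm] at hy
    refine (hpos y).2 ⟨?_, (hm_pos y).2 (hy.trans_lt (by nlinarith))⟩
    have h1 := hq_ge y
    have h2 : (Q : ℝ) * ‖y - x₀‖ ≤ Q * (κ * r) := mul_le_mul_of_nonneg_left hy hQ0
    nlinarith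
  refine ⟨r, w, hrη, hwL, fun x => le_max_right _ _, fun x => ?_, fun x hx => ?_,
    hball.trans hΩ, ⟨x₀, hin (Metric.mem_closedBall_self (by positivity))⟩, ?_, ?_, fun x hx => ?_⟩
  · refine max_le ((min_le_right _ _).trans ?_) (by positivity)
    simp only [hm]
    exact mul_le_mul_of_nonneg_left (by linarith [norm_nonneg (x - x₀)]) hMpos.le
  · rw [Metric.mem_closedBall, dist_eq_norm]
    linarith [hpos_lt x hx]
  · have h1 := Measure.addHaar_closedBall_mul (volume : Measure (RSpace n)) x₀
      (show 0 ≤ 3 / κ by positivity) (show 0 ≤ κ * r by positivity)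
    rw [show 3 / κ * (κ * r) = 3 * r by field_simp, finrank_euclideanSpace_fin,
      ← Measure.addHaar_closedBall_center (volume : Measure (RSpace n)) x₀] at h1
    rw [h1]
    exact mul_le_mul_right (measure_mono (hin.trans subset_closure)) _
  · refine measure_mono_null (fun y hy => ?_) htn
    have hcl : closure {x | 0 < w x} ⊆ {y | 0 ≤ q y ∧ ‖y - x₀‖ ≤ 2 * r / 3} := by
      refine closure_minimal (fun z hz => ⟨((hpos z).1 hz).1.le, (hpos_lt z hz).le⟩) ?_
      exact (isClosed_le continuous_const hqL.continuous).inter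
        (isClosed_le (continuous_id.sub continuous_const).norm continuous_const)
    obtain ⟨h1, h2⟩ := hcl hy.1
    have h3 : 0 < m y := (hm_pos y).2 (by linarith)
    have h4 : ¬ 0 < q y := fun h => hy.2 ((hpos y).2 ⟨h, h3⟩)
    have h5 : q y = 0 := le_antisymm (not_lt.1 h4) h1
    simp only [hq] at h5
    show U y - H (y - x₀) = t
    linarith
  · refine ⟨t, ?_⟩
    filter_upwards [(isOpen_lt continuous_const hwL.continuous).mem_nhds hx] with y hy
    have hy' : 0 < w y := hy
    have h3 : U y = u y := (hUu (hball (by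
      rw [Metric.mem_closedBall, dist_eq_norm]; linarith [hpos_lt y hy']))).symm
    rw [hwq y hy', ← h3]
    simp only [hq]
    ring

/-- If `∇u` lies a.e. in the interior of the set whose support function is `H`, with a uniform
margin `δ`, then there are small Lipschitz corrections `w` supported in `Ω` such that `u - w` is
locally, almost everywhere in `Ω`, a translate of `H` up to a constant. -/
theorem exists_lipschitz_correction {n : ℕ} {Ω : Set (RSpace n)} (hΩ : IsOpen Ω) {L L₀ : ℝ≥0}
    {δ : ℝ} (hδ : 0 < δ) {u H : RSpace n → ℝ} (hH : LipschitzWith L₀ H) (hH0 : H 0 = 0)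
    (hu : ∀ x r, Metric.closedBall x r ⊆ Ω → LipschitzOnWith L u (Metric.closedBall x r))
    (hae : ∀ᵐ x ∂volume.restrict Ω, ∃ ζ, HasGradientAt u ζ x ∧
      ∀ y, inner ℝ ζ y + δ * ‖y‖ ≤ H y) :
    ∃ K : ℝ≥0, ∀ τ : ℝ, 0 < τ → ∃ w : RSpace n → ℝ, LipschitzWith K w ∧ (∀ x, 0 ≤ w x) ∧
      (∀ x, w x ≤ τ) ∧ (∀ x ∉ Ω, w x = 0) ∧
      ∀ᵐ x ∂volume.restrict Ω, ∃ x₀ b, (fun y => u y - w y) =ᶠ[𝓝 x] fun y => H (y - x₀) + b := by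
  obtain ⟨K, C, hKC⟩ := exists_isLocalCorrection (L := L) hδ hH hH0
  refine ⟨K, fun τ hτ => ?_⟩
  set η : ℝ := τ / (K + 1) with hη
  have hη0 : 0 < η := by positivity
  have hKη : K * η ≤ τ := by
    rw [hη, mul_div_assoc', div_le_iff₀ (by positivity)]
    nlinarith [K.2]
  set s : Set (RSpace n) := {x | x ∈ Ω ∧ ∃ ζ, HasGradientAt u ζ x ∧
      ∀ y, inner ℝ ζ y + δ * ‖y‖ ≤ H y} with hs
  set t : Set ((RSpace n × ℝ) × (RSpace n → ℝ)) :=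
    {a | a.1.2 ≤ η ∧ IsLocalCorrection Ω u H K C a.1.1 a.1.2 a.2} with ht
  have hfine : ∀ x ∈ s, ∀ ε > 0, ∃ a ∈ t, a.1.2 ≤ ε ∧ a.1.1 = x := by
    rintro x ⟨hx, ζ, hζ, hζH⟩ ε hε
    obtain ⟨r₀, hr₀, hr₀Ω⟩ := Metric.nhds_basis_closedBall.mem_iff.1 (hΩ.mem_nhds hx)
    obtain ⟨r, w, hr, hw⟩ := hKC Ω u x ζ r₀ hr₀ hr₀Ω (hu x r₀ hr₀Ω) hζ hζH (min ε η) (by positivity)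
    exact ⟨((x, r), w), ⟨hr.trans (min_le_right _ _), hw⟩, hr.trans (min_le_left _ _), rfl⟩
  have hopen : ∀ a ∈ t, IsOpen {x | 0 < a.2 x} := fun a ha =>
    isOpen_lt continuous_const ha.2.lipschitz.continuous
  -- The covering sets are the closures of the positivity sets, not balls; `volume_le` supplies the
  -- required comparison with the ball of triple radius.
  obtain ⟨v, hvt, hvc, hvd, hv0⟩ := Vitali.exists_disjoint_covering_ae volume s t C
    (fun a => a.1.2) (fun a => a.1.1) (fun a => closure {x | 0 < a.2 x})
    (fun a ha => closure_minimal ha.2.subset_closedBall Metric.isClosed_closedBall)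
    (fun a ha => ha.2.volume_le)
    (fun a ha => ha.2.nonempty.mono (interior_maximal subset_closure (hopen a ha)))
    (fun a _ => isClosed_closure) hfine
  have hle : ∀ a ∈ v, ∀ x, a.2 x ≤ τ := fun a ha x =>
    ((hvt ha).2.le x).trans ((mul_le_mul_of_nonneg_left (hvt ha).1 K.2).trans hKη)
  have hbdd : ∀ x, BddAbove (range fun a : v => (a : (RSpace n × ℝ) × (RSpace n → ℝ)).2 x) :=
    fun x => ⟨τ, by rintro _ ⟨a, rfl⟩; exact hle a a.2 x⟩
  -- At most one term is positive at each point, and a supremum keeps the common Lipschitz constant.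
  -- If `v` is empty, the real supremum is `0`.
  set w : RSpace n → ℝ := fun x => ⨆ a : v, (a : (RSpace n × ℝ) × (RSpace n → ℝ)).2 x with hw
  have hw0 : ∀ x, 0 ≤ w x := fun x => Real.iSup_nonneg fun a => (hvt a.2).2.nonneg x
  have hzero : ∀ a ∈ t, ∀ x ∉ Ω, a.2 x = 0 := fun a ha x hx => by
    refine le_antisymm (not_lt.1 fun h => hx ?_) (ha.2.nonneg x)
    exact ha.2.closedBall_subset (ha.2.subset_closedBall h)
  refine ⟨w, LipschitzWith.of_le_add_mul K fun x y => ?_, hw0, fun x => ?_, fun x hx => ?_, ?_⟩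
  · refine Real.iSup_le (fun a => ?_) (add_nonneg (hw0 y) (by positivity))
    exact ((hvt a.2).2.lipschitz.le_add_mul x y).trans
      (add_le_add_left (le_ciSup (hbdd y) a) _)
  · exact Real.iSup_le (fun a => hle a a.2 x) hτ.le
  · refine le_antisymm (Real.iSup_le (fun a => ?_) le_rfl) (hw0 x)
    exact (hzero a (hvt a.2) x hx).le
  · have hnull : ∀ᵐ x, ∀ a ∈ v, x ∉ closure {x | 0 < a.2 x} \ {x | 0 < a.2 x} :=
      (ae_ball_iff hvc).2 fun a ha =>
        measure_eq_zero_iff_ae_notMem.1 (hvt ha).2.volume_closure_diff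
    filter_upwards [hae, ae_restrict_mem hΩ.measurableSet, ae_restrict_of_ae hnull,
      ae_restrict_of_ae (measure_eq_zero_iff_ae_notMem.1 hv0)] with x h1 h2 h3 h4
    have h5 : x ∈ ⋃ a ∈ v, closure {x | 0 < a.2 x} := by
      by_contra h
      exact h4 ⟨⟨h2, h1⟩, h⟩
    obtain ⟨a, ha, hxa⟩ := mem_iUnion₂.1 h5
    have hpos : 0 < a.2 x := by
      by_contra h
      exact h3 a ha ⟨hxa, h⟩
    obtain ⟨b, hb⟩ := (hvt ha).2.eventuallyEq x hpos
    refine ⟨a.1.1, b, ?_⟩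
    filter_upwards [hb, (hopen a (hvt ha)).mem_nhds hpos] with y hy1 hy2
    have : w y = a.2 y := by
      refine le_antisymm (Real.iSup_le (fun c => ?_) ((hvt ha).2.nonneg y))
        (le_ciSup (hbdd y) ⟨a, ha⟩)
      by_cases hca : (c : (RSpace n × ℝ) × (RSpace n → ℝ)) = a
      · rw [hca]
      · refine (not_lt.1 fun hc => ?_).trans ((hvt ha).2.nonneg y)
        exact disjoint_left.1 (hvd c.2 ha hca) (subset_closure hc) (subset_closure hy2)
    rw [this, hy1]

/-! ### Support functions and sublevel sets of the envelope. -/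

theorem IsCompact.exists_support_function {n : ℕ} {A : Set (RSpace n)} (hA : IsCompact A)
    (hne : A.Nonempty) : ∃ (H : RSpace n → ℝ) (L : ℝ≥0), LipschitzWith L H ∧ H 0 = 0 ∧
      (∀ ξ ∈ A, ∀ x, inner ℝ ξ x ≤ H x) ∧
      ∀ x, DifferentiableAt ℝ H x → gradient H x ∈ A := by
  have hmax : ∀ x : RSpace n, ∃ ξ ∈ A, ∀ η ∈ A, (inner ℝ η x : ℝ) ≤ inner ℝ ξ x := fun x => by
    obtain ⟨ξ, hξ, h⟩ := hA.exists_isMaxOn hne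
      (f := fun η => (inner ℝ η x : ℝ)) (continuous_id.inner continuous_const).continuousOn
    exact ⟨ξ, hξ, fun η hη => h hη⟩
  choose p hpA hp using hmax
  obtain ⟨R, hR⟩ := hA.isBounded.exists_norm_le
  have hR0 : 0 ≤ R := (norm_nonneg _).trans (hR _ (hpA 0))
  refine ⟨fun x => inner ℝ (p x) x, ⟨R, hR0⟩, LipschitzWith.of_le_add_mul _ fun x y => ?_, by simp,
    fun ξ hξ x => hp x ξ hξ, fun x hx => ?_⟩
  · have h1 := hp y (p x) (hpA x)
    have h2 : (inner ℝ (p x) (x - y) : ℝ) ≤ R * dist x y := by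
      rw [dist_eq_norm]
      exact (real_inner_le_norm _ _).trans
        (mul_le_mul_of_nonneg_right (hR _ (hpA x)) (norm_nonneg _))
    rw [inner_sub_right] at h2
    show _ ≤ _ + R * dist x y
    linarith
  · have hlin : HasGradientAt (fun y => (inner ℝ (p x) y : ℝ)) (p x) x := by
      rw [hasGradientAt_iff_hasFDerivAt]
      exact (InnerProductSpace.toDual ℝ (RSpace n) (p x)).hasFDerivAt
    -- The difference of `H` and the linear function of its maximizer `p x` is nonnegative and
    -- vanishes at `x`. So the gradient of `H` there is `p x`, a point of `A` itself and not merely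
    -- of its convex hull.
    have hmin : IsLocalMin ((fun y => (inner ℝ (p y) y : ℝ)) - fun y => inner ℝ (p x) y) x := by
      refine Eventually.of_forall fun y => ?_
      have := hp y (p x) (hpA x)
      simp only [Pi.sub_apply, sub_self]
      linarith
    have h0 := hmin.gradient_eq_zero
    rw [gradient_sub_apply hx hlin.differentiableAt, hlin.gradient, sub_eq_zero] at h0
    rw [h0]
    exact hpA x

theorem isClosed_lslcEnvelope_le {n : ℕ} (f : RSpace n → EReal) (c : ℝ) :
    IsClosed {ξ | lslcEnvelope f ξ ≤ c} ∧ Convex ℝ {ξ | lslcEnvelope f ξ ≤ c} := by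
  have h : {ξ | lslcEnvelope f ξ ≤ c} = ⋂ g : {g : RSpace n → EReal // LowerSemicontinuous g ∧
      IsLevelConvex g ∧ ∀ η, g η ≤ f η}, {ξ | g.1 ξ ≤ c} := by
    ext ξ
    simp only [lslcEnvelope, mem_iInter, mem_ofPred_eq]
    constructor
    · intro h g
      refine le_trans (le_sSup ?_) h
      exact ⟨g.1, g.2.1, g.2.2.1, g.2.2.2, rfl⟩
    · intro h
      refine sSup_le ?_
      rintro _ ⟨g, h1, h2, h3, rfl⟩
      exact h ⟨g, h1, h2, h3⟩
  rw [h]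
  exact ⟨isClosed_iInter fun g => g.2.1.isClosed_preimage _, convex_iInter fun g => g.2.2.1 c⟩

theorem lslcEnvelope_le {n : ℕ} (f : RSpace n → EReal) (ξ : RSpace n) :
    lslcEnvelope f ξ ≤ f ξ := by
  refine sSup_le ?_
  rintro _ ⟨g, _, _, h, rfl⟩
  exact h ξ

/-- The function equal to `⊥` on `S` and `c` elsewhere is a competitor: its sublevel sets are `S` or
the whole space. -/
theorem le_lslcEnvelope_of_notMem {n : ℕ} {f : RSpace n → EReal} {S : Set (RSpace n)}
    (hS : IsClosed S) (hS' : Convex ℝ S) {c : EReal} (hc : ∀ η ∉ S, c ≤ f η) {ζ : RSpace n}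
    (hζ : ζ ∉ S) : c ≤ lslcEnvelope f ζ := by
  classical
  refine le_sSup ⟨fun η => if η ∈ S then ⊥ else c, ?_, fun a => ?_, fun η => ?_, by simp [hζ]⟩
  · intro η b hb
    by_cases hη : η ∈ S
    · simp [hη] at hb
    · filter_upwards [hS.isOpen_compl.mem_nhds hη] with y hy
      have hy' : y ∉ S := hy
      simpa [hη, hy'] using hb
  · by_cases ha : c ≤ a
    · have : {ξ | (if ξ ∈ S then ⊥ else c) ≤ (a : EReal)} = univ := by
        ext ξ
        by_cases h : ξ ∈ S <;> simp [h, ha]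
      rw [this]
      exact convex_univ
    · have : {ξ | (if ξ ∈ S then ⊥ else c) ≤ (a : EReal)} = S := by
        ext ξ
        by_cases h : ξ ∈ S <;> simp [h, ha]
      rwa [this]
  · by_cases h : η ∈ S <;> simp [h, hc]

/-- By compactness a closed `δ`-neighbourhood of `{f ≤ c₁}` fits inside `{f < c}`. A point where the
envelope is below `c₁` lies in every closed convex set containing `{f ≤ c₁}`, in particular in the
half-space expressing the margin in direction `x`. -/
theorem exists_margin_of_lslcEnvelope_lt {n : ℕ} {f : RSpace n → ℝ} (hf : Continuous f)
    (hcomp : ∀ c : ℝ, IsCompact {ξ | f ξ ≤ c}) {c₁ c : ℝ} (hc : c₁ < c) :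
    ∃ δ : ℝ, 0 < δ ∧ ∀ ζ, lslcEnvelope (fun ξ => (f ξ : EReal)) ζ < c₁ →
      ∀ x, ∃ ξ, f ξ ≤ c ∧ inner ℝ ζ x + δ * ‖x‖ ≤ inner ℝ ξ x := by
  obtain ⟨δ, hδ, hδf⟩ := (hcomp c₁).exists_cthickening_subset_open
    (isOpen_lt hf (continuous_const (y := c))) (fun ξ hξ => lt_of_le_of_lt hξ hc)
  refine ⟨δ, hδ, fun ζ hζ x => ?_⟩
  have hsep : ∀ S : Set (RSpace n), IsClosed S → Convex ℝ S → (∀ η, f η ≤ c₁ → η ∈ S) → ζ ∈ S := by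
    intro S h1 h2 h3
    by_contra h
    refine (le_lslcEnvelope_of_notMem h1 h2 (fun η hη => ?_) h).not_gt hζ
    exact EReal.coe_le_coe_iff.2 (not_le.1 fun h' => hη (h3 η h')).le
  rcases {ξ | f ξ ≤ c}.eq_empty_or_nonempty with he | hne
  · exfalso
    refine hsep ∅ isClosed_empty convex_empty fun η hη => ?_
    rw [← he]
    exact hη.trans hc.le
  obtain ⟨ξ, hξ, hmax⟩ := (hcomp c).exists_isMaxOn hne
    (f := fun η => (inner ℝ η x : ℝ)) (continuous_id.inner continuous_const).continuousOn
  refine ⟨ξ, hξ, ?_⟩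
  refine hsep {η | inner ℝ η x + δ * ‖x‖ ≤ inner ℝ ξ x} ?_ ?_ fun η hη => ?_
  · exact isClosed_le ((continuous_id.inner continuous_const).add continuous_const)
      continuous_const
  · have : {η : RSpace n | inner ℝ η x + δ * ‖x‖ ≤ inner ℝ ξ x}
        = {η | innerSL ℝ x η ≤ inner ℝ ξ x - δ * ‖x‖} := by
      ext η
      simp only [mem_ofPred_eq, innerSL_apply_apply]
      rw [real_inner_comm x η, le_sub_iff_add_le]
    rw [this]
    exact convex_halfSpace_le (innerSL ℝ x).toLinearMap.isLinear _
  · rcases eq_or_ne x 0 with rfl | hx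
    · simp
    have hx' : ‖x‖ ≠ 0 := norm_ne_zero_iff.2 hx
    -- Moving `η` by `δ` in the direction of `x` stays in `{f ≤ c}` and raises the inner product by
    -- `δ ‖x‖`.
    have h1 : η + (δ / ‖x‖) • x ∈ Metric.cthickening δ {ξ | f ξ ≤ c₁} := by
      refine Metric.mem_cthickening_of_dist_le _ η δ _ hη ?_
      rw [dist_eq_norm, add_sub_cancel_left, norm_smul, norm_div, norm_norm,
        Real.norm_of_nonneg hδ.le, div_mul_cancel₀ _ hx']
    have h4 : f (η + (δ / ‖x‖) • x) ≤ c := le_of_lt (hδf h1)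
    have h2 := hmax h4
    simp only [mem_ofPred_eq, inner_add_left, real_inner_smul_left, real_inner_self_eq_norm_sq] at h2
    have h3 : δ / ‖x‖ * ‖x‖ ^ 2 = δ * ‖x‖ := by field_simp
    rwa [h3] at h2

theorem isCompact_sublevel {n : ℕ} {f : RSpace n → ℝ} (hf : Continuous f) {γ : ℝ≥0 → ℝ≥0}
    (hγ_lim : Tendsto γ atTop atTop) (hfγ : ∀ ξ, (γ ‖ξ‖₊ : ℝ) ≤ f ξ) (c : ℝ) :
    IsCompact {ξ | f ξ ≤ c} := by
  refine Metric.isCompact_of_isClosed_isBounded (isClosed_le hf continuous_const) ?_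
  obtain ⟨R, hR⟩ := eventually_atTop.1 (hγ_lim.eventually_gt_atTop c.toNNReal)
  refine (Metric.isBounded_closedBall (x := (0 : RSpace n)) (r := R)).subset fun ξ hξ => ?_
  rw [mem_closedBall_zero_iff]
  by_contra! h
  have h1 := hR ‖ξ‖₊ (by exact_mod_cast h.le)
  have h2 : (γ ‖ξ‖₊ : ℝ) ≤ c := (hfγ ξ).trans hξ
  exact absurd h2 (not_le.2 ((Real.le_coe_toNNReal c).trans_lt (NNReal.coe_lt_coe.2 h1)))

/-! ### Weak-* convergence of gradients of uniformly small Lipschitz functions. -/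

/-- The derivatives are uniformly bounded, so `g` may be replaced by a smooth `ψ` close in `L¹`;
integration by parts then puts the derivative on `ψ` and leaves the small factor `w k`. -/
theorem tendsto_setIntegral_fderiv_mul {n : ℕ} {Ω : Set (RSpace n)} {K : ℝ≥0}
    {w : ℕ → RSpace n → ℝ} (hw : ∀ k, LipschitzWith K (w k)) (h0 : ∀ k x, 0 ≤ w k x)
    (hz : ∀ k, ∀ x ∉ Ω, w k x = 0) {τ : ℕ → ℝ} (hτ : ∀ k x, w k x ≤ τ k)
    (hτ0 : Tendsto τ atTop (𝓝 0)) {g : RSpace n → ℝ} (hg : Integrable g (volume.restrict Ω))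
    (v : RSpace n) :
    Tendsto (fun k => ∫ x in Ω, fderiv ℝ (w k) x v * g x) atTop (𝓝 0) := by
  rw [Metric.tendsto_nhds]
  intro ε hε
  set D : ℝ := K * ‖v‖ + 1 with hD
  have hD0 : 0 < D := by positivity
  obtain ⟨ψ, hψc, hψs, hψ⟩ := (memLp_one_iff_integrable.2 hg).exist_eLpNorm_sub_le
    ENNReal.one_ne_top le_rfl (show 0 < ε / (2 * D) by positivity)
  have hψi : Integrable ψ := hψs.continuous.integrable_of_hasCompactSupport hψc
  have hgψ : Integrable (g - ψ) (volume.restrict Ω) := hg.sub hψi.restrict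
  have hψ' : ∫ x in Ω, ‖(g - ψ) x‖ ≤ ε / (2 * D) := by
    rw [eLpNorm_one_eq_lintegral_enorm, ← ofReal_integral_norm_eq_lintegral_enorm hgψ] at hψ
    exact (ENNReal.ofReal_le_ofReal_iff (by positivity)).1 hψ
  have hmeas : ∀ k, Measurable fun x => fderiv ℝ (w k) x v := fun k =>
    measurable_fderiv_apply_const ℝ (w k) v
  have hb : ∀ k x, ‖fderiv ℝ (w k) x v‖ ≤ K * ‖v‖ := fun k x =>
    ((fderiv ℝ (w k) x).le_opNorm v).trans
      (mul_le_mul_of_nonneg_right (norm_fderiv_le_of_lipschitz ℝ (hw k)) (norm_nonneg _))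
  have hI : Integrable fun x => lineDeriv ℝ ψ x (-v) := by
    simp_rw [fun x => ((hψs.differentiable (by simp)) x).lineDeriv_eq_fderiv (v := -v)]
    refine Continuous.integrable_of_hasCompactSupport
      ((hψs.continuous_fderiv (by simp)).clm_apply continuous_const) ?_
    exact (hψc.fderiv ℝ).comp_left (g := fun l : RSpace n →L[ℝ] ℝ => l (-v)) (by simp)
  have hfirst : ∀ k, |∫ x in Ω, fderiv ℝ (w k) x v * ψ x|
      ≤ τ k * ∫ x, ‖lineDeriv ℝ ψ x (-v)‖ := by
    intro k
    obtain ⟨C, hC⟩ := ContDiff.lipschitzWith_of_hasCompactSupport hψc hψs (by simp)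
    have h1 : ∫ x in Ω, fderiv ℝ (w k) x v * ψ x = ∫ x, lineDeriv ℝ ψ x (-v) * w k x := by
      rw [← (hw k).integral_lineDeriv_mul_eq hC hψc v]
      rw [setIntegral_eq_integral_of_forall_compl_eq_zero]
      · refine integral_congr_ae ?_
        filter_upwards [(hw k).ae_differentiableAt] with x hx
        rw [hx.lineDeriv_eq_fderiv]
      · intro x hx
        -- `ψ` need not be supported in `Ω`; the integral extends to the whole space because `w k`
        -- has a minimum at each point outside `Ω`.
        have : IsLocalMin (w k) x := Eventually.of_forall fun y => by
          rw [hz k x hx]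
          exact h0 k y
        rw [this.fderiv_eq_zero]
        simp
    rw [h1, ← Real.norm_eq_abs, ← integral_const_mul]
    refine norm_integral_le_of_norm_le (hI.norm.const_mul _) (Eventually.of_forall fun x => ?_)
    rw [norm_mul, Real.norm_of_nonneg (h0 k x), mul_comm]
    exact mul_le_mul_of_nonneg_right (hτ k x) (norm_nonneg _)
  have hlim : Tendsto (fun k => τ k * ∫ x, ‖lineDeriv ℝ ψ x (-v)‖) atTop (𝓝 0) := by
    simpa using hτ0.mul_const (∫ x, ‖lineDeriv ℝ ψ x (-v)‖)
  filter_upwards [hlim.eventually_lt_const (half_pos hε)] with k hk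
  have hint : ∀ {F : RSpace n → ℝ}, Integrable F (volume.restrict Ω) →
      Integrable (fun x => fderiv ℝ (w k) x v * F x) (volume.restrict Ω) := fun hF =>
    hF.bdd_mul (hmeas k).aestronglyMeasurable (Eventually.of_forall (hb k))
  have hsplit : ∫ x in Ω, fderiv ℝ (w k) x v * g x
      = (∫ x in Ω, fderiv ℝ (w k) x v * ψ x) + ∫ x in Ω, fderiv ℝ (w k) x v * (g - ψ) x := by
    rw [← integral_add (hint hψi.restrict) (hint hgψ)]
    refine integral_congr_ae (Eventually.of_forall fun x => ?_)
    simp only [Pi.sub_apply]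
    ring
  have hsecond : |∫ x in Ω, fderiv ℝ (w k) x v * (g - ψ) x| ≤ ε / 2 := by
    calc |∫ x in Ω, fderiv ℝ (w k) x v * (g - ψ) x|
        ≤ ∫ x in Ω, D * ‖(g - ψ) x‖ := by
          rw [← Real.norm_eq_abs]
          refine norm_integral_le_of_norm_le (hgψ.norm.const_mul _)
            (Eventually.of_forall fun x => ?_)
          rw [norm_mul]
          exact mul_le_mul_of_nonneg_right ((hb k x).trans (by simp [hD])) (norm_nonneg _)
      _ ≤ D * (ε / (2 * D)) := by
          rw [integral_const_mul]
          exact mul_le_mul_of_nonneg_left hψ' hD0.le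
      _ = ε / 2 := by field_simp
  rw [Real.dist_eq, sub_zero, hsplit]
  exact (abs_add_le _ _).trans_lt (by linarith [hfirst k])

theorem tendsto_setIntegral_inner_gradient {n : ℕ} {Ω : Set (RSpace n)} {K : ℝ≥0}
    {w : ℕ → RSpace n → ℝ} (hw : ∀ k, LipschitzWith K (w k)) (h0 : ∀ k x, 0 ≤ w k x)
    (hz : ∀ k, ∀ x ∉ Ω, w k x = 0) {τ : ℕ → ℝ} (hτ : ∀ k x, w k x ≤ τ k)
    (hτ0 : Tendsto τ atTop (𝓝 0)) {g : RSpace n → RSpace n}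
    (hg : Integrable g (volume.restrict Ω)) :
    Tendsto (fun k => ∫ x in Ω, inner ℝ (gradient (w k) x) (g x)) atTop (𝓝 0) := by
  have hgi : ∀ i : Fin n, Integrable (fun x => g x i) (volume.restrict Ω) := fun i =>
    (EuclideanSpace.proj (𝕜 := ℝ) i).integrable_comp hg
  have hexp : ∀ k x, inner ℝ (gradient (w k) x) (g x)
      = ∑ i : Fin n, fderiv ℝ (w k) x (EuclideanSpace.single i 1) * g x i := by
    intro k x
    rw [PiLp.inner_apply]
    refine Finset.sum_congr rfl fun i _ => ?_
    rw [← inner_gradient_eq_fderiv, EuclideanSpace.inner_single_left]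
    simp [mul_comm]
  have hsum : ∀ k, ∫ x in Ω, inner ℝ (gradient (w k) x) (g x)
      = ∑ i : Fin n, ∫ x in Ω, fderiv ℝ (w k) x (EuclideanSpace.single i 1) * g x i := by
    intro k
    simp_rw [hexp]
    refine integral_finsetSum _ fun i _ => ?_
    refine (hgi i).bdd_mul (c := K * ‖EuclideanSpace.single i (1 : ℝ)‖)
      (measurable_fderiv_apply_const ℝ (w k) _).aestronglyMeasurable
      (Eventually.of_forall fun x => ?_)
    exact ((fderiv ℝ (w k) x).le_opNorm _).trans
      (mul_le_mul_of_nonneg_right (norm_fderiv_le_of_lipschitz ℝ (hw k)) (norm_nonneg _))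
  simp_rw [hsum]
  have := tendsto_finsetSum (Finset.univ : Finset (Fin n)) fun i _ =>
    tendsto_setIntegral_fderiv_mul hw h0 hz hτ hτ0 (hgi i) (EuclideanSpace.single i 1)
  simpa using this

/-! ### Lower bound for the relaxed functional. -/

/-- A closed convex pointwise constraint on the gradients passes to weak-* limits. -/
theorem WeakStarTendsto.ae_weakGrad_mem {n : ℕ} {Ω : Set (RSpace n)} (hΩ : IsOpen Ω)
    (hb : Bornology.IsBounded Ω) {us : ℕ → RSpace n → ℝ} {u : RSpace n → ℝ}
    (h : WeakStarTendsto Ω us u) (hus : ∀ k, MemW1Infty Ω (us k)) (hu : MemW1Infty Ω u)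
    {S : Set (RSpace n)} (hS : IsClosed S) (hS' : Convex ℝ S)
    (hmem : ∃ᶠ k in atTop, ∀ᵐ x ∂volume.restrict Ω, weakGrad Ω (us k) x ∈ S) :
    ∀ᵐ x ∂volume.restrict Ω, weakGrad Ω u x ∈ S := by
  have : IsFiniteMeasure (volume.restrict Ω) :=
    ⟨by rw [Measure.restrict_apply_univ]; exact hb.measure_lt_top⟩
  have hint : ∀ {w : RSpace n → ℝ}, MemW1Infty Ω w → ∀ v : RSpace n,
      Integrable (fun x => (inner ℝ v (weakGrad Ω w x) : ℝ)) (volume.restrict Ω) := fun hw v =>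
    ((hw.memLp_weakGrad hΩ).integrable (by simp)).const_inner v
  -- Testing with `v` times the indicator of `B` passes the half-space bound to the limit of the
  -- averages. Infinitely many good `k` suffice because the whole sequence of integrals converges.
  have hhalf : ∀ (v : RSpace n) (a : ℝ), (∀ ξ ∈ S, inner ℝ v ξ ≤ a) →
      ∀ᵐ x ∂volume.restrict Ω, inner ℝ v (weakGrad Ω u x) ≤ a := by
    intro v a hva
    refine ae_le_of_forall_setIntegral_le (hint hu v) (integrable_const a) fun B hB _ => ?_
    have e : ∀ w : RSpace n → ℝ,
        ∫ x in Ω, inner ℝ (weakGrad Ω w x) (B.indicator (fun _ => v) x)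
          = ∫ x in B, inner ℝ v (weakGrad Ω w x) ∂volume.restrict Ω := by
      intro w
      rw [← integral_indicator hB]
      refine integral_congr_ae (Eventually.of_forall fun x => ?_)
      by_cases hx : x ∈ B <;> simp [hx, real_inner_comm]
    have hlim := h.2 (B.indicator fun _ => v) ((integrable_const v).indicator hB)
    simp_rw [e] at hlim
    by_contra! hlt
    obtain ⟨k, hk1, hk2⟩ := (hmem.and_eventually (hlim.eventually_const_lt hlt)).exists
    refine absurd hk2 (not_lt.2 ?_)
    refine integral_mono_ae (hint (hus k) v).restrict (integrable_const a) ?_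
    filter_upwards [ae_restrict_of_ae hk1] with x hx
    exact hva _ hx
  have hsep : ∀ ξ ∈ Sᶜ, ∃ v : RSpace n, ∃ a : ℝ, (∀ η ∈ S, inner ℝ v η ≤ a) ∧
      a < inner ℝ v ξ := by
    intro ξ hξ
    obtain ⟨l, a, hl, ha⟩ := geometric_hahn_banach_closed_point hS' hS hξ
    refine ⟨(InnerProductSpace.toDual ℝ (RSpace n)).symm l, a, fun η hη => ?_, ?_⟩
    · rw [InnerProductSpace.toDual_symm_apply]
      exact (hl η hη).le
    · rwa [InnerProductSpace.toDual_symm_apply]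
  choose! v a hva hξ using hsep
  -- By Lindelöf, countably many half-spaces cut out `S`, so the exceptional null sets can be
  -- united.
  obtain ⟨T, hTS, hT, hcov⟩ := TopologicalSpace.countable_cover_nhdsWithin
    (f := fun ξ => {η | a ξ < inner ℝ (v ξ) η}) (s := Sᶜ)
    (fun ξ hx => mem_nhdsWithin_of_mem_nhds
      ((isOpen_lt continuous_const (continuous_const.inner continuous_id)).mem_nhds (hξ ξ hx)))
  filter_upwards [(ae_ball_iff hT).2 fun ξ hx => hhalf (v ξ) (a ξ) (hva ξ (hTS hx))] with x hx
  by_contra hxS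
  obtain ⟨ξ, hξT, hlt⟩ := mem_iUnion₂.1 (hcov hxS)
  exact not_lt.2 (hx ξ hξT) hlt

theorem memW1Infty_of_mem_dirichletClass {n : ℕ} {Ω : Set (RSpace n)}
    (hb : Bornology.IsBounded Ω) {u₀ u : RSpace n → ℝ} (hu₀ : MemW1Infty Ω u₀)
    (hu : u ∈ dirichletClass Ω u₀) : MemW1Infty Ω u := by
  have h0 : MemW1Infty Ω (fun _ : RSpace n => (0 : ℝ)) :=
    (LipschitzWith.const (0 : ℝ)).memW1Infty hb
  have h1 : MemW1Infty Ω (u - u₀) := hu.1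
  have := h1.sub (h0.sub hu₀)
  convert this using 1
  ext x
  simp

theorem supremalFunctional_lslcEnvelope_le_relaxed {n : ℕ} {Ω : Set (RSpace n)} (hΩ : IsOpen Ω)
    (hb : Bornology.IsBounded Ω) (f : RSpace n → EReal) {u₀ : RSpace n → ℝ}
    (hu₀ : MemW1Infty Ω u₀) {u : RSpace n → ℝ} (hu : u ∈ dirichletClass Ω u₀) :
    supremalFunctional Ω (lslcEnvelope f) u
      ≤ relaxedFunctional Ω (dirichletClass Ω u₀) (supremalFunctional Ω f) u := by
  refine le_sInf ?_
  rintro _ ⟨us, hus, hlim, rfl⟩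
  refine le_of_forall_gt_imp_ge_of_dense fun b hb' => ?_
  obtain ⟨c, hc1, hc2⟩ := EReal.lt_iff_exists_real_btwn.1 hb'
  have hfreq : ∃ᶠ k in atTop, ∀ᵐ x ∂volume.restrict Ω,
      weakGrad Ω (us k) x ∈ {ξ | lslcEnvelope f ξ ≤ c} := by
    refine (frequently_lt_of_liminf_lt (by isBoundedDefault) hc1).mono fun k hk => ?_
    filter_upwards [ae_le_essSup (μ := volume.restrict Ω)
      (f := fun x => f (weakGrad Ω (us k) x))] with x hx
    exact (lslcEnvelope_le f _).trans (hx.trans hk.le)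
  have hcl := isClosed_lslcEnvelope_le f c
  have := hlim.ae_weakGrad_mem hΩ hb (fun k => memW1Infty_of_mem_dirichletClass hb hu₀ (hus k))
    (memW1Infty_of_mem_dirichletClass hb hu₀ hu) hcl.1 hcl.2 hfreq
  exact (essSup_le_of_ae_le (c : EReal) this).trans hc2.le

/-! ### Upper bound for the relaxed functional. -/

theorem weakStarTendsto_sub {n : ℕ} {Ω : Set (RSpace n)} (hΩ : IsOpen Ω)
    (hb : Bornology.IsBounded Ω) {u : RSpace n → ℝ} (hu : MemW1Infty Ω u) {K : ℝ≥0}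
    {w : ℕ → RSpace n → ℝ} (hw : ∀ k, LipschitzWith K (w k)) (h0 : ∀ k x, 0 ≤ w k x)
    (hz : ∀ k, ∀ x ∉ Ω, w k x = 0) {τ : ℕ → ℝ} (hτ : ∀ k x, w k x ≤ τ k)
    (hτ0 : Tendsto τ atTop (𝓝 0)) : WeakStarTendsto Ω (fun k => u - w k) u := by
  constructor
  · intro g hg
    have h1 : Tendsto (fun k => ∫ x in Ω, w k x * g x) atTop (𝓝 0) := by
      have hlim : Tendsto (fun k => τ k * ∫ x in Ω, ‖g x‖) atTop (𝓝 0) := by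
        simpa using hτ0.mul_const (∫ x in Ω, ‖g x‖)
      refine squeeze_zero_norm (fun k => ?_) hlim
      rw [← integral_const_mul]
      refine norm_integral_le_of_norm_le (hg.norm.const_mul _) (Eventually.of_forall fun x => ?_)
      rw [norm_mul, Real.norm_of_nonneg (h0 k x)]
      exact mul_le_mul_of_nonneg_right (hτ k x) (norm_nonneg _)
    have h2 := (tendsto_const_nhds (x := ∫ x in Ω, u x * g x)).sub h1
    rw [sub_zero] at h2
    refine h2.congr fun k => ?_
    have hi1 : Integrable (fun x => u x * g x) (volume.restrict Ω) := hg.mul_of_top_right hu.1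
    have hi2 : Integrable (fun x => w k x * g x) (volume.restrict Ω) :=
      hg.mul_of_top_right ((hw k).memW1Infty hb).1
    rw [← integral_sub hi1 hi2]
    refine integral_congr_ae (Eventually.of_forall fun x => ?_)
    simp only [Pi.sub_apply]
    ring
  · intro g hg
    have h1 := tendsto_setIntegral_inner_gradient hw h0 hz hτ hτ0 hg
    have h2 := (tendsto_const_nhds (x := ∫ x in Ω, inner ℝ (weakGrad Ω u x) (g x))).sub h1
    rw [sub_zero] at h2
    refine h2.congr fun k => ?_
    have hi : ∀ {G : RSpace n → RSpace n}, MemLp G ∞ (volume.restrict Ω) →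
        Integrable (fun x => (inner ℝ (G x) (g x) : ℝ)) (volume.restrict Ω) := by
      intro G hG
      obtain ⟨C, -, hC⟩ := hG.exists_ae_norm_le
      refine (hg.norm.const_mul C).mono' (hG.1.inner hg.1) ?_
      filter_upwards [hC] with x hx
      exact (norm_inner_le_norm _ _).trans (mul_le_mul_of_nonneg_right hx (norm_nonneg _))
    have hgr : MemLp (gradient (w k)) ∞ (volume.restrict Ω) :=
      memLp_top_of_bound (measurable_gradient _).aestronglyMeasurable K
        (Eventually.of_forall (hw k).norm_gradient_le)
    rw [← integral_sub (hi (hu.memLp_weakGrad hΩ)) (hi hgr)]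
    refine integral_congr_ae ?_
    filter_upwards [weakGrad_ae_eq hΩ (hu.hasWeakGradient.sub ((hw k).hasWeakGradient Ω))]
      with x hx
    rw [hx, Pi.sub_apply, inner_sub_left]

theorem relaxedFunctional_le {n : ℕ} {Ω : Set (RSpace n)} {A : Set (RSpace n → ℝ)}
    {F : (RSpace n → ℝ) → EReal} {u : RSpace n → ℝ} {us : ℕ → RSpace n → ℝ}
    (hA : ∀ k, us k ∈ A) (h : WeakStarTendsto Ω us u) {c : EReal} (hc : ∀ k, F (us k) ≤ c) :
    relaxedFunctional Ω A F u ≤ c :=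
  le_trans (sInf_le (by exact ⟨us, hA, h, rfl⟩))
    (liminf_le_of_frequently_le' (Frequently.of_forall hc))

theorem relaxed_le_supremalFunctional_lslcEnvelope {n : ℕ} {Ω : Set (RSpace n)} (hΩ : IsOpen Ω)
    (hb : Bornology.IsBounded Ω) {f : RSpace n → ℝ} (hf : Continuous f)
    (hcomp : ∀ c : ℝ, IsCompact {ξ | f ξ ≤ c}) {u₀ : RSpace n → ℝ}
    (hu₀ : MemW1Infty Ω u₀) {u : RSpace n → ℝ} (hu : u ∈ dirichletClass Ω u₀) :
    relaxedFunctional Ω (dirichletClass Ω u₀) (supremalFunctional Ω (fun ξ => (f ξ : EReal))) u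
      ≤ supremalFunctional Ω (lslcEnvelope (fun ξ => (f ξ : EReal))) u := by
  -- For empty `Ω` the ess sup is `⊥` and the constant sequence works; otherwise `Ω` has positive
  -- measure, which yields a point of `{f ≤ c}`.
  rcases Ω.eq_empty_or_nonempty with rfl | hne
  · refine relaxedFunctional_le (us := fun _ => u) (fun _ => hu)
      ⟨fun g _ => tendsto_const_nhds, fun g _ => tendsto_const_nhds⟩ fun _ => ?_
    simp [supremalFunctional]
  have huW := memW1Infty_of_mem_dirichletClass hb hu₀ hu
  refine le_of_forall_gt_imp_ge_of_dense fun b hb' => ?_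
  obtain ⟨c₁, hc1, hc1b⟩ := EReal.lt_iff_exists_real_btwn.1 hb'
  obtain ⟨c, hc1c, hcb⟩ := EReal.lt_iff_exists_real_btwn.1 hc1b
  refine le_trans ?_ hcb.le
  obtain ⟨δ, hδ, hmargin⟩ := exists_margin_of_lslcEnvelope_lt hf hcomp
    (EReal.coe_lt_coe_iff.1 hc1c)
  have henv : ∀ᵐ x ∂volume.restrict Ω,
      lslcEnvelope (fun ξ => (f ξ : EReal)) (weakGrad Ω u x) < c₁ := by
    filter_upwards [ae_le_essSup (μ := volume.restrict Ω)
      (f := fun x => lslcEnvelope (fun ξ => (f ξ : EReal)) (weakGrad Ω u x))] with x hx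
    exact lt_of_le_of_lt hx hc1
  have hA : {ξ | f ξ ≤ c}.Nonempty := by
    have : (ae (volume.restrict Ω)).NeBot := by
      rw [ae_neBot, Ne, Measure.restrict_eq_zero]
      exact (hΩ.measure_pos volume hne).ne'
    obtain ⟨x, hx⟩ := henv.exists
    obtain ⟨ξ, hξ, _⟩ := hmargin _ hx 0
    exact ⟨ξ, hξ⟩
  obtain ⟨H, L₀, hHL, hH0, hHle, hHgrad⟩ := (hcomp c).exists_support_function hA
  obtain ⟨C, -, hC⟩ := (huW.memLp_weakGrad hΩ).exists_ae_norm_le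
  have hL : ∀ᵐ x ∂volume.restrict Ω, ‖weakGrad Ω u x‖ ≤ C.toNNReal := by
    filter_upwards [hC] with x hx
    exact hx.trans (Real.le_coe_toNNReal C)
  -- The corrections are built from the Lipschitz representative `v`, but subtracted from `u`
  -- itself.
  obtain ⟨v, hvu, hv⟩ := huW.hasWeakGradient.exists_lipschitz_representative hΩ huW.1 hL
  have hvg := (huW.hasWeakGradient.congr hvu.symm).ae_hasGradientAt hΩ hv
  obtain ⟨K, hK⟩ := exists_lipschitz_correction hΩ hδ hHL hH0 hv (by
    filter_upwards [hvg, henv] with x hx1 hx2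
    refine ⟨_, hx1, fun y => ?_⟩
    obtain ⟨ξ, hξ, hle⟩ := hmargin _ hx2 y
    exact hle.trans (hHle ξ hξ y))
  choose w hwL hw0 hwτ hwz hwH using fun k : ℕ => hK (1 / ((k : ℝ) + 1)) (by positivity)
  refine relaxedFunctional_le (us := fun k => u - w k) (fun k => ?_)
    (weakStarTendsto_sub hΩ hb huW hwL hw0 hwz hwτ tendsto_one_div_add_atTop_nhds_zero_nat)
    fun k => ?_
  · have h := MemW1InftyZero.sub hΩ hu ((hwL k).memW1InftyZero hΩ hb (hw0 k) (hwz k))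
    show MemW1InftyZero Ω (u - w k - u₀)
    rwa [sub_right_comm]
  · refine essSup_le_of_ae_le (c : EReal) ?_
    filter_upwards [weakGrad_ae_eq hΩ (huW.hasWeakGradient.sub ((hwL k).hasWeakGradient Ω)), hvg,
      hwH k, ae_restrict_of_ae (hwL k).ae_differentiableAt] with x hx hxv ⟨x₀, b', hxH⟩ hxw
    have hd : DifferentiableAt ℝ (v - w k) x := hxv.differentiableAt.sub hxw
    have hg : gradient (v - w k) x = weakGrad Ω u x - gradient (w k) x := by
      rw [gradient_sub_apply hxv.differentiableAt hxw, hxv.gradient]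
    have hH' : HasGradientAt (fun y => H (y - x₀) + b') (gradient (v - w k) x) x :=
      hd.hasGradientAt.congr_of_eventuallyEq hxH.symm
    -- Differentiability of `H` at `x - x₀` is inherited from `v - w k` at `x`, so the null set
    -- where `H` fails to be differentiable need not be tracked through the translations.
    have hH'' : HasGradientAt H (gradient (v - w k) x) (x - x₀) := by
      rw [hasGradientAt_iff_hasFDerivAt] at hH' ⊢
      have h1 := hH'.sub_const b'
      simp only [add_sub_cancel_right] at h1
      exact (hasFDerivAt_comp_sub x₀).1 h1
    have := hHgrad _ hH''.differentiableAt
    rw [hH''.gradient, hg] at this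
    rw [hx]
    exact EReal.coe_le_coe_iff.2 this

theorem mainTheorem6 (n : ℕ) (hn : 1 ≤ n) (Ω : Set (RSpace n)) (hΩ_open : IsOpen Ω)
    (hΩ_bdd : Bornology.IsBounded Ω) (hΩ_lip : HasLipschitzBoundary Ω)
    (f : RSpace n → ℝ) (hf : Continuous f)
    (γ : ℝ≥0 → ℝ≥0) (hγ_cont : Continuous γ) (hγ_mono : Monotone γ)
    (hγ_lim : Tendsto γ atTop atTop) (hfγ : ∀ ξ, (γ ‖ξ‖₊ : ℝ) ≤ f ξ)
    (u₀ : RSpace n → ℝ) (hu₀ : MemW1Infty Ω u₀)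
    (u : RSpace n → ℝ) (hu : u ∈ dirichletClass Ω u₀) :
    relaxedFunctional Ω (dirichletClass Ω u₀)
        (supremalFunctional Ω (fun ξ => (f ξ : EReal))) u
      = supremalFunctional Ω (lslcEnvelope (fun ξ => (f ξ : EReal))) u :=
  le_antisymm
    (relaxed_le_supremalFunctional_lslcEnvelope hΩ_open hΩ_bdd hf
      (isCompact_sublevel hf hγ_lim hfγ) hu₀ hu)
    (supremalFunctional_lslcEnvelope_le_relaxed hΩ_open hΩ_bdd _ hu₀ hu)
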